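/- **Setting.** Let $d\in\mathbb N$ and let $\vec a=(a_1,\dots,a_d)$ satisfy $a_i>0$ and $\sum_i a_i=d$. Put $D_{\vec a}(t)=\operatorname{diag}(t^{a_1},\dots,t^{a_d})$ for $t>0$. Let $|0|_{\vec a}=0$, and for $\xi\neq0$ let $|\xi|_{\vec a}$ be the unique $t>0$ with $|D_{\vec a}(1/t)\xi|=1$. Write $B_d(\xi,s)=\{\zeta\in\mathbb R^d:|\zeta-\xi|_{\vec a}<s\}$. A function $h$ is *moderate on* a set $S\subset\mathbb R^d\setminus\{0\}$ if there are $R,\delta_0>0$ such that $\xi,\zeta\in S$ and $|\xi-\zeta|_{\vec a}\le\delta_0h(\xi)$ imply $R^{-1}\le h(\xi)/h(\zeta)\le R$. A *hybrid regulation function* with exponent $r\ge1$ is a function $\tilde h=\rho h_1+(1-\rho)h_2$ on $\mathbb R^d\setminus\{0\}$, where * $\rho:\mathbb R^d\setminus\{0\}\to[0,1]$ is $C^1$, $\rho(\xi)=1$ for $0<|\xi|_{\vec a}\le 2/3$ and $\rho(\xi)=0$ for $|\xi|_{\vec a}\ge4/3$; * $h_1,h_2:\mathbb R^d\setminus\{0\}\to(0,\infty)$;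 $h_1$ is moderate on $\{0<|\xi|_{\vec a}\le4/3\}$ and satisfies $c_0|\xi|_{\vec a}^r\le h_1(\xi)\le c_1|\xi|_{\vec a}$ there; $h_2$ is moderate on $\{|\xi|_{\vec a}\ge2/3\}$ and satisfies $c_2\le h_2(\xi)\le c_3|\xi|_{\vec a}$ there, for some constants $c_0,\dots,c_3>0$. A family of measurable sets indexed by $J$ is an *admissible covering* of $\mathbb R^d\setminus\{0\}$ if its union is $\mathbb R^d\setminus\{0\}$ and the number of indices $i$ whose set meets the $j$-th set is bounded uniformly in $j$. Let $J\ne\emptyset$ be countable, and let $T_j\xi=A_j\xi+b_j$ ($j\in J$) be invertible affine maps and $P,Q$ bounded open sets with $\overline P\subset Q\subset\mathbb R^d\setminus\{0\}$. The family $\{T_jQ\}_{j\in J}$ is a *structured admissible covering* if $\{T_jP\}$ and $\{T_jQ\}$ are both admissible coverings of $\mathbb R^d\setminus\{0\}$ and the entries of $A_k^{-1}A_j$ are bounded uniformly over all $j,k$ with $T_jQ\cap T_kQ\neq\emptyset$. Let $\tilde h$ be a hybrid regulation function with exponent $r$, let $\delta>0$ and $\xi_j\in\mathbb R^d\setminus\{0\}$,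 and let $\{T_jQ\}_{j\in J}$ be a structured admissible covering with $A_j=D_{\vec a}(\delta\tilde h(\xi_j))$ and $T_jQ=B_d(\xi_j,\delta\tilde h(\xi_j))$ for all $j$. Let $\Phi\in C^\infty(\mathbb R^d)$ be non-negative with $\Phi=1$ on $P$ and $\operatorname{supp}\Phi\subset Q$, and let $$\phi_j(\xi)=\frac{\Phi(T_j^{-1}\xi)}{\sqrt{\sum_{k\in J}\Phi(T_k^{-1}\xi)^2}}\quad(\xi\ne0),\qquad \phi_j(0)=0 .$$ Given $C>0$, put $J_2=\{j\in J:B_d(\xi_j,\delta\tilde h(\xi_j))\cap B_d(0,C)=\emptyset\}$ and $J_1=J\setminus J_2$. For $\psi\in\mathcal S(\mathbb R^d)$ write $\check\psi(x)=(2\pi)^{-d}\int\psi(\xi)e^{ix\cdot\xi}\,d\xi$, so that convolution with $\check\psi$ is the Fourier multiplier with symbol $\psi$; $\check\phi_j^2$ denotes $(\phi_j^2)^\vee$. Let $\mathcal P\subset\mathcal S'(\mathbb R^d)$ be the space of polynomials, and give $\mathcal S'/\mathcal P$ the quotient topology of the topology of pointwise convergence on $\mathcal S'$. The Fourier transform $\hat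 f$ has order $\le m$ if there are $l$ and $c$ with $|\langle\hat f,\psi\rangle|\le c\,\sup_{|\alpha|\le l,|\beta|\le m}\sup_x|x^\alpha\partial^\beta\psi(x)|$ for all $\psi\in\mathcal S$. **Lemma.** For every $d$, $\vec a$ and $r$ there is a function $p:\mathbb N\to\mathbb N$ such that in every setting as above with these $d,\vec a,r$ the functions $\phi_j$ belong to $\mathcal S(\mathbb R^d)$ and the following holds for every $C>0$ and every $f\in\mathcal S'(\mathbb R^d)$. 1. The series $\sum_{j\in J_1}\check\phi_j^2*f$ and $\sum_{j\in J_2}\check\phi_j^2*f$ converge (unconditionally) in $\mathcal S'/\mathcal P$, and $$f=\sum_{j\in J_1}\check\phi_j^2*f+\sum_{j\in J_2}\check\phi_j^2*f\quad\text{in }\mathcal S'/\mathcal P .$$ 2. If $\hat f$ has order $\le m$, then for all increasing sequences of finite sets $(F_k)_k$ with union $J_1$ and $(G_K)_K$ with union $J_2$ (for instance the initial segments of numberings of $J_1$ by $-1,-2,\dots$ and of $J_2$ by $1,2,\dots$) there are polynomials $P_k$ with $\deg P_k\le p(m)$ and a polynomial $P_0$ such that $$\sum_{j\in F_k}\check\phi_j^2*f+\sum_{j\in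 G_K}\check\phi_j^2*f+P_k\;\longrightarrow\; f-P_0\quad\text{in }\mathcal S'\text{ as }k,K\to\infty .$$ -/

import Mathlib

open Filter Topology MeasureTheory
open scoped SchwartzMap FourierTransform ContDiff

noncomputable section

namespace HomDecomp

/-- Euclidean space `ℝ^d`. -/
abbrev E (d : ℕ) : Type := EuclideanSpace ℝ (Fin d)

/-! ### Anisotropic norm -/

/-- An anisotropy on `ℝ^d`: positive exponents with `a_1 + ... + a_d = d`. -/
structure IsAnisotropy {d : ℕ} (a : Fin d → ℝ) : Prop where
  pos : ∀ i, 0 < a i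
  sum_eq : ∑ i, a i = d

/-- The anisotropic dilation matrix `D_a(t) = diag(t^{a_1}, ..., t^{a_d})`. -/
def dilation {d : ℕ} (a : Fin d → ℝ) (t : ℝ) : Matrix (Fin d) (Fin d) ℝ :=
  Matrix.diagonal fun i => t ^ a i

/-- A matrix acting on `ℝ^d`. -/
def act {d : ℕ} (M : Matrix (Fin d) (Fin d) ℝ) (ξ : E d) : E d := Matrix.toLpLin 2 2 M ξ

/-- The anisotropic norm: `|ξ|_a` is the unique `t > 0` with `|D_a(1/t) ξ| = 1` if `ξ ≠ 0`.
For `ξ = 0` the set below is empty, and the value is `sInf ∅ = 0`; for `ξ ≠ 0` the set is a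
singleton (see `anorm_eq_iff`). -/
def anorm {d : ℕ} (a : Fin d → ℝ) (ξ : E d) : ℝ :=
  sInf {t : ℝ | 0 < t ∧ ‖act (dilation a (1 / t)) ξ‖ = 1}

theorem norm_act_dilation_sq {d : ℕ} (a : Fin d → ℝ) (s : ℝ) (ξ : E d) :
    ‖act (dilation a s) ξ‖ ^ 2 = ∑ i, (s ^ a i * ξ i) ^ 2 := by
  rw [EuclideanSpace.norm_sq_eq]
  refine Finset.sum_congr rfl fun i _ => ?_
  rw [Real.norm_eq_abs, sq_abs]
  simp [act, dilation, Matrix.toLpLin_apply, Matrix.mulVec_diagonal]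

/-- For `ξ ≠ 0`, the anisotropic norm is the unique solution `t > 0` of `|D_a(1/t) ξ| = 1`. -/
theorem anorm_eq_iff {d : ℕ} {a : Fin d → ℝ} (ha : IsAnisotropy a) {ξ : E d} (hξ : ξ ≠ 0)
    (t : ℝ) : anorm a ξ = t ↔ 0 < t ∧ ‖act (dilation a (1 / t)) ξ‖ = 1 := by
  obtain ⟨i₀, hi₀⟩ : ∃ i, ξ i ≠ 0 := by
    by_contra! h
    exact hξ (by ext i; exact h i)
  let g : ℝ → ℝ := fun s => ∑ i, (s ^ a i * ξ i) ^ 2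
  have hiff : ∀ s, ‖act (dilation a s) ξ‖ = 1 ↔ g s = 1 := fun s => by
    have h1 : g s = ‖act (dilation a s) ξ‖ ^ 2 := (norm_act_dilation_sq a s ξ).symm
    rw [h1]
    exact (pow_eq_one_iff_of_nonneg (norm_nonneg _) two_ne_zero).symm
  have hmono : ∀ s u, 0 < s → s < u → g s < g u := by
    intro s u hs hsu
    refine Finset.sum_lt_sum (fun i _ => ?_) ⟨i₀, Finset.mem_univ _, ?_⟩
    · rw [mul_pow, mul_pow]
      have := Real.rpow_le_rpow hs.le hsu.le (ha.pos i).le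
      have := Real.rpow_nonneg hs.le (a i)
      gcongr
    · rw [mul_pow, mul_pow]
      have := Real.rpow_lt_rpow hs.le hsu (ha.pos i₀)
      have := Real.rpow_nonneg hs.le (a i₀)
      have : 0 < ξ i₀ ^ 2 := by positivity
      gcongr
  have huniq : ∀ s u, 0 < s → 0 < u → g s = 1 → g u = 1 → s = u := by
    intro s u hs hu h1 h2
    rcases lt_trichotomy s u with h | h | h
    · exact absurd (hmono s u hs h) (by rw [h1, h2]; exact lt_irrefl _)
    · exact h
    · exact absurd (hmono u s hu h) (by rw [h1, h2]; exact lt_irrefl _)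
  have hcont : Continuous g := by
    refine continuous_finsetSum _ fun i _ => ((Continuous.mul ?_ continuous_const).pow 2)
    exact Real.continuous_rpow_const (ha.pos i).le
  have h0 : g 0 = 0 := by
    refine Finset.sum_eq_zero fun i _ => ?_
    rw [Real.zero_rpow (ha.pos i).ne']
    simp
  have hpos : 0 < |ξ i₀| := abs_pos.mpr hi₀
  let u : ℝ := (1 / |ξ i₀|) ^ (1 / a i₀)
  have hu : 0 < u := by positivity
  have hgu : 1 ≤ g u := by
    have h1 : (u ^ a i₀ * ξ i₀) ^ 2 = 1 := by
      have : u ^ a i₀ = 1 / |ξ i₀| := by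
        rw [← Real.rpow_mul (by positivity), one_div_mul_cancel (ha.pos i₀).ne', Real.rpow_one]
      rw [this, mul_pow, div_pow, sq_abs, one_pow, one_div, inv_mul_cancel₀ (by positivity)]
    rw [← h1]
    exact Finset.single_le_sum (f := fun i => (u ^ a i * ξ i) ^ 2) (fun i _ => sq_nonneg _)
      (Finset.mem_univ i₀)
  obtain ⟨s, hs, hs1⟩ := intermediate_value_Icc hu.le hcont.continuousOn
    (show (1 : ℝ) ∈ Set.Icc (g 0) (g u) from ⟨by rw [h0]; exact zero_le_one, hgu⟩)
  have hs0 : 0 < s := by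
    rcases hs.1.lt_or_eq with h | h
    · exact h
    · rw [← h, h0] at hs1; exact absurd hs1 zero_ne_one
  have hset : {t : ℝ | 0 < t ∧ ‖act (dilation a (1 / t)) ξ‖ = 1} = {1 / s} := by
    ext t
    simp only [Set.mem_ofPred_eq, Set.mem_singleton_iff, hiff]
    constructor
    · rintro ⟨ht, h⟩
      rw [huniq s (1 / t) hs0 (by positivity) hs1 h, one_div_one_div]
    · rintro rfl
      exact ⟨by positivity, by rw [one_div_one_div]; exact hs1⟩
  have hval : anorm a ξ = 1 / s := by rw [anorm, hset, csInf_singleton]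
  have hmem : t ∈ {t : ℝ | 0 < t ∧ ‖act (dilation a (1 / t)) ξ‖ = 1} ↔ t ∈ ({1 / s} : Set ℝ) := by
    rw [hset]
  rw [hval]
  exact ⟨fun h => hmem.mpr h.symm, fun h => (hmem.mp h).symm⟩

/-- The open ball of the quasi-distance `d(ξ, ζ) = |ξ - ζ|_a`. -/
def aball {d : ℕ} (a : Fin d → ℝ) (c : E d) (r : ℝ) : Set (E d) := {ζ | anorm a (ζ - c) < r}

/-! ### Structured admissible coverings of `ℝ^d \ {0}` -/

/-- An admissible covering of `ℝ^d \ {0}`: measurable sets whose union is `ℝ^d \ {0}` such that the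
number of neighbours of each set is uniformly bounded. -/
structure IsAdmissibleCovering {d : ℕ} {J : Type*} (Q : J → Set (E d)) : Prop where
  measurable : ∀ j, MeasurableSet (Q j)
  cover : ⋃ j, Q j = {0}ᶜ
  finite_overlap : ∃ N : ℕ, ∀ j, {i | (Q i ∩ Q j).Nonempty}.encard ≤ N

/-- The image `A S + b` of a set under the affine map `ξ ↦ A ξ + b`. -/
def affImage {d : ℕ} (A : Matrix (Fin d) (Fin d) ℝ) (b : E d) (S : Set (E d)) : Set (E d) :=
  (fun ξ => act A ξ + b) '' S

/-- `{A_j Q + b_j}` is a structured admissible covering of `ℝ^d \ {0}`, with inner set `P`. -/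
structure IsStructuredCovering {d : ℕ} {J : Type*} (A : J → Matrix (Fin d) (Fin d) ℝ)
    (b : J → E d) (P Q : Set (E d)) : Prop where
  nonempty : Nonempty J
  countable : Countable J
  invertible : ∀ j, IsUnit (A j).det
  isOpen_inner : IsOpen P
  isOpen_outer : IsOpen Q
  bounded : Bornology.IsBounded Q
  zero_notMem : (0 : E d) ∉ Q
  compactly_contained : closure P ⊆ Q
  admissible_inner : IsAdmissibleCovering fun j => affImage (A j) (b j) P
  admissible_outer : IsAdmissibleCovering fun j => affImage (A j) (b j) Q
  transition_bounded : ∃ K : ℝ, ∀ j k,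
    (affImage (A j) (b j) Q ∩ affImage (A k) (b k) Q).Nonempty →
      ∀ i l, |((A k)⁻¹ * A j) i l| ≤ K

/-! ### Hybrid regulation functions -/

/-- Moderateness of `h` on the set `S` with respect to the quasi-distance `|ξ - ζ|_a`. -/
def IsModerateOn {d : ℕ} (a : Fin d → ℝ) (S : Set (E d)) (h : E d → ℝ) : Prop :=
  ∃ R δ₀ : ℝ, 0 < R ∧ 0 < δ₀ ∧ ∀ ξ ∈ S, ∀ ζ ∈ S,
    anorm a (ξ - ζ) ≤ δ₀ * h ξ → R⁻¹ ≤ h ξ / h ζ ∧ h ξ / h ζ ≤ R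

/-- The region `0 < |ξ|_a ≤ 4/3` in which the low-frequency function `h₁` is used. -/
def lowRegion {d : ℕ} (a : Fin d → ℝ) : Set (E d) := {ξ | ξ ≠ 0 ∧ anorm a ξ ≤ 4 / 3}

/-- The region `2/3 ≤ |ξ|_a` in which the high-frequency function `h₂` is used. -/
def highRegion {d : ℕ} (a : Fin d → ℝ) : Set (E d) := {ξ | ξ ≠ 0 ∧ 2 / 3 ≤ anorm a ξ}

/-- A hybrid regulation function `h = ρ h₁ + (1 - ρ) h₂` on `ℝ^d \ {0}`, where `r ≥ 1` is the
exponent in the lower bound for `h₁`. The conditions on `h₁` and on `h₂` are imposed where these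
functions enter `h`: no function `h₂` satisfies `c₂ ≤ h₂(ξ) ≤ c₃ |ξ|_a` near the origin. Values at
`ξ = 0` are irrelevant. -/
def IsHybridRegulation {d : ℕ} (a : Fin d → ℝ) (r : ℝ) (h : E d → ℝ) : Prop :=
  ∃ ρ h₁ h₂ : E d → ℝ,
    (ContDiffOn ℝ 1 ρ {0}ᶜ ∧ (∀ ξ, ξ ≠ 0 → 0 ≤ ρ ξ ∧ ρ ξ ≤ 1) ∧
      (∀ ξ, ξ ≠ 0 → anorm a ξ ≤ 2 / 3 → ρ ξ = 1) ∧ (∀ ξ, 4 / 3 ≤ anorm a ξ → ρ ξ = 0)) ∧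
    (∀ ξ, ξ ≠ 0 → 0 < h₁ ξ ∧ 0 < h₂ ξ) ∧
    IsModerateOn a (lowRegion a) h₁ ∧ IsModerateOn a (highRegion a) h₂ ∧
    1 ≤ r ∧
    (∃ c₀ c₁ : ℝ, 0 < c₀ ∧ 0 < c₁ ∧
      ∀ ξ ∈ lowRegion a, c₀ * anorm a ξ ^ r ≤ h₁ ξ ∧ h₁ ξ ≤ c₁ * anorm a ξ) ∧
    (∃ c₂ c₃ : ℝ, 0 < c₂ ∧ 0 < c₃ ∧
      ∀ ξ ∈ highRegion a, c₂ ≤ h₂ ξ ∧ h₂ ξ ≤ c₃ * anorm a ξ) ∧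
    ∀ ξ, ξ ≠ 0 → h ξ = ρ ξ * h₁ ξ + (1 - ρ ξ) * h₂ ξ

/-! ### The square root of a BAPU -/

/-- `g_j(ξ) = Φ(T_j⁻¹ ξ)`, where `T_j ξ = A ξ + b`. -/
def bump {d : ℕ} (Φ : E d → ℝ) (A : Matrix (Fin d) (Fin d) ℝ) (b : E d) (ξ : E d) : ℝ :=
  Φ (act A⁻¹ (ξ - b))

/-- `φ_j = g_j / √(∑_k g_k²)`. The sum is locally finite on `ℝ^d \ {0}`, and the value at `0` is
`0`, since no `g_k` charges the origin. -/
def sqrtBAPU {d : ℕ} {J : Type*} (Φ : E d → ℝ) (A : J → Matrix (Fin d) (Fin d) ℝ) (b : J → E d)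
    (j : J) (ξ : E d) : ℝ :=
  bump Φ (A j) (b j) ξ / √(∑' k, bump Φ (A k) (b k) ξ ^ 2)

/-- A generating function for the square root of a BAPU. -/
structure IsGenerator {d : ℕ} (P Q : Set (E d)) (Φ : E d → ℝ) : Prop where
  smooth : ContDiff ℝ ∞ Φ
  nonneg : ∀ ξ, 0 ≤ Φ ξ
  eq_one : ∀ ξ ∈ P, Φ ξ = 1
  support : tsupport Φ ⊆ Q

/-! ### Convolution with Schwartz functions -/

/-- The reflection `x ↦ u (-x)` of a Schwartz function. -/
def reflect {d : ℕ} (u : 𝓢(E d, ℂ)) : 𝓢(E d, ℂ) :=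
  SchwartzMap.compCLMOfContinuousLinearEquiv ℂ (ContinuousLinearEquiv.neg ℝ) u

/-- The convolution `u * f` of a Schwartz function with a tempered distribution:
`⟨u * f, ψ⟩ = ⟨f, u(-·) * ψ⟩`. -/
def conv {d : ℕ} (u : 𝓢(E d, ℂ)) (f : 𝓢'(E d, ℂ)) : 𝓢'(E d, ℂ) :=
  PointwiseConvergenceCLM.precomp ℂ
    (SchwartzMap.convolution (ContinuousLinearMap.mul ℂ ℂ) (reflect u)) f

theorem conv_apply {d : ℕ} (u : 𝓢(E d, ℂ)) (f : 𝓢'(E d, ℂ)) (ψ : 𝓢(E d, ℂ)) :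
    conv u f ψ = f (SchwartzMap.convolution (ContinuousLinearMap.mul ℂ ℂ) (reflect u) ψ) := rfl

/-- Multiplication by `2π` on `ℝ^d`. -/
def scale (d : ℕ) : E d ≃L[ℝ] E d :=
  ContinuousLinearEquiv.smulLeft (Units.mk0 (2 * Real.pi) (by positivity))

/-- The convolution kernel `ψ̌` of the Fourier multiplier with symbol `ψ`, in the convention where
frequencies are paired as `e^{i x·ξ}`: `ψ̌(x) = (2π)^{-d} ∫ ψ(ξ) e^{i x·ξ} dξ`, see
`kernel_apply`. -/
def kernel {d : ℕ} (ψ : 𝓢(E d, ℂ)) : 𝓢(E d, ℂ) :=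
  𝓕⁻ (SchwartzMap.compCLMOfContinuousLinearEquiv ℂ (scale d) ψ)

theorem kernel_apply {d : ℕ} (ψ : 𝓢(E d, ℂ)) (x : E d) :
    kernel ψ x = (((2 * Real.pi) ^ d)⁻¹ : ℝ) •
      ∫ ξ : E d, Complex.exp (Complex.I * (inner ℝ x ξ : ℝ)) * ψ ξ := by
  have h := Measure.integral_comp_smul (volume : Measure (E d))
    (fun ξ : E d => Complex.exp (Complex.I * (inner ℝ x ξ : ℝ)) * ψ ξ) (2 * Real.pi)
  have hpos : (0 : ℝ) < (2 * Real.pi) ^ d := by positivity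
  rw [finrank_euclideanSpace_fin, abs_of_pos (inv_pos.mpr hpos)] at h
  rw [← h, kernel, SchwartzMap.fourierInv_coe, Real.fourierInv_eq']
  refine integral_congr_ae (Eventually.of_forall fun ξ => ?_)
  simp only [SchwartzMap.compCLMOfContinuousLinearEquiv_apply, Function.comp_apply, smul_eq_mul]
  have : scale d ξ = (2 * Real.pi) • ξ := rfl
  rw [this, inner_smul_right, real_inner_comm]
  congr 2
  push_cast
  ring

/-- The pointwise square of a Schwartz function. -/
def square {d : ℕ} (φ : 𝓢(E d, ℂ)) : 𝓢(E d, ℂ) :=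
  SchwartzMap.pairing (ContinuousLinearMap.mul ℂ ℂ) φ φ

/-! ### Polynomials as tempered distributions -/

/-- The function on `ℝ^d` defined by a polynomial with complex coefficients. -/
def polyFun {d : ℕ} (P : MvPolynomial (Fin d) ℂ) (x : E d) : ℂ :=
  MvPolynomial.eval (fun i => ((x i : ℝ) : ℂ)) P

theorem polyFun_hasTemperateGrowth {d : ℕ} (P : MvPolynomial (Fin d) ℂ) :
    (polyFun P).HasTemperateGrowth := by
  induction P using MvPolynomial.induction_on with
  | C c =>
    have : polyFun (MvPolynomial.C c : MvPolynomial (Fin d) ℂ) = fun _ => c := by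
      funext x; simp [polyFun]
    rw [this]
    exact Function.HasTemperateGrowth.const c
  | add p q hp hq =>
    have : polyFun (p + q) = polyFun p + polyFun q := by
      funext x; simp [polyFun]
    rw [this]
    exact hp.add hq
  | mul_X p i hp =>
    have : polyFun (p * MvPolynomial.X i) =
        polyFun p * fun x : E d => Complex.ofRealCLM (EuclideanSpace.proj (𝕜 := ℝ) i x) := by
      funext x; simp [polyFun]
    rw [this]
    exact hp.mul (ContinuousLinearMap.hasTemperateGrowth
      (Complex.ofRealCLM ∘L EuclideanSpace.proj (𝕜 := ℝ) i))

/-- A polynomial as a tempered distribution, `ψ ↦ ∫ P(x) ψ(x) dx`. -/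
def polyDist {d : ℕ} : MvPolynomial (Fin d) ℂ →ₗ[ℂ] 𝓢'(E d, ℂ) where
  toFun P := (polyFun_hasTemperateGrowth P).toTemperedDistribution volume
  map_add' P₁ P₂ := by
    ext ψ
    have h (P : MvPolynomial (Fin d) ℂ) : Integrable fun x : E d => ψ x • polyFun P x :=
      (SchwartzMap.bilinLeftCLM (ContinuousLinearMap.lsmul ℂ ℂ)
        (polyFun_hasTemperateGrowth P) ψ).integrable
    refine Eq.trans ?_ (integral_add (h P₁) (h P₂))
    refine integral_congr_ae (Eventually.of_forall fun x => ?_)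
    simp [polyFun, mul_add]
  map_smul' c P := by
    ext ψ
    refine Eq.trans ?_ (integral_smul c fun x : E d => ψ x • polyFun P x)
    refine integral_congr_ae (Eventually.of_forall fun x => ?_)
    simp [polyFun, mul_left_comm]

theorem polyDist_apply {d : ℕ} (P : MvPolynomial (Fin d) ℂ) (ψ : 𝓢(E d, ℂ)) :
    polyDist P ψ = ∫ x : E d, ψ x * polyFun P x := rfl

/-- The space `𝒫` of polynomials, as a subspace of `𝒮'`. -/
def polys (d : ℕ) : Submodule ℂ 𝓢'(E d, ℂ) := LinearMap.range (polyDist (d := d))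

/-! ### Order of the Fourier transform -/

/-- `f̂` has order `≤ m`: `|⟨f̂, ψ⟩|` is bounded by finitely many of the seminorms
`sup |x|^k ‖D^n ψ(x)‖` with at most `m` derivatives. This does not depend on the normalization of
the Fourier transform. -/
def FourierOrderLE {d : ℕ} (m : ℕ) (f : 𝓢'(E d, ℂ)) : Prop :=
  ∃ (l : ℕ) (C : ℝ), ∀ ψ : 𝓢(E d, ℂ),
    ‖(𝓕 f) ψ‖ ≤ C * ((Finset.Iic (l, m)).sup (schwartzSeminormFamily ℂ (E d) ℂ)) ψ

/-- The Fourier transform of every tempered distribution has finite order. -/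
theorem exists_fourierOrderLE {d : ℕ} (f : 𝓢'(E d, ℂ)) : ∃ m, FourierOrderLE m f := by
  let q : Seminorm ℂ 𝓢(E d, ℂ) := (normSeminorm ℂ ℂ).comp (𝓕 f).toLinearMap
  have hq : Continuous q := by
    have h : Continuous fun ψ : 𝓢(E d, ℂ) => (𝓕 f) ψ := map_continuous (𝓕 f)
    exact h.norm
  obtain ⟨s, C, -, hC⟩ :=
    Seminorm.bound_of_continuous (schwartz_withSeminorms ℂ (E d) ℂ) q hq
  refine ⟨s.sup Prod.snd, s.sup Prod.fst, C, fun ψ => (hC ψ).trans ?_⟩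
  have hs : s ⊆ Finset.Iic (s.sup Prod.fst, s.sup Prod.snd) := fun i hi =>
    Finset.mem_Iic.mpr ⟨Finset.le_sup (f := Prod.fst) hi, Finset.le_sup (f := Prod.snd) hi⟩
  exact mul_le_mul_of_nonneg_left
    (Finset.sup_mono (f := schwartzSeminormFamily ℂ (E d) ℂ) hs ψ) C.2

/-- An increasing sequence of finite sets with union `S`. -/
structure IsExhaustion {J : Type*} (S : Set J) (F : ℕ → Finset J) : Prop where
  mono : Monotone F
  union : ⋃ k, (F k : Set J) = S

end HomDecomp

end

open HomDecomp

universe u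

/-!
On the frequency side, convolution with the kernel of `φ_j²` is multiplication of `f̂` by
`θ_j = φ_j²` (`conv_kernel_apply`), and the `θ_j` form a partition of unity of `ℝ^d \ {0}`. So the
question is in which sense `∑_{j ∈ F} θ_j η → η` for the finite subsets `F` of `J`, when tested
against a functional that controls only `m` derivatives of `η` (and any decay).

The one quantitative input is the bound `‖D^i θ_j(ξ)‖ ≤ B_i max(1, ‖ξ‖^{-κ})^i` with `κ` depending
only on `d`, `a` and `r`. It comes from `‖A_j⁻¹‖ ≲ max(1, ‖ξ‖^{-κ})` for `ξ ∈ T_j Q`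
(`IsHybridRegulation.exists_bound_inv_rpow`): the quasi-ball `T_j Q = B(ξ_j, δ h(ξ_j))` does not
contain the origin, so `ξ` is at most of the size of `ξ_j`, and `h(ξ_j) ≳ min(1, |ξ_j|^r)`. Families
with such bounds and uniformly bounded overlap are called tame (`IsTameFamily`); the squares of the
functions `Φ ∘ T_j⁻¹` form one, and dividing a tame family by its sum preserves tameness
(`IsTameFamily.div_partialSum`).

Consequently, if `η` vanishes to order `κ m + m` at the origin, all derivatives of order at most `m`
of `(∑_{j ∉ F} θ_j) η` are bounded by a multiple of `min(‖ξ‖, 1 / ‖ξ‖)`, uniformly in `F`, and they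
vanish on a given annulus once `F` contains the finitely many indices whose sets meet it. Hence they
tend to `0` uniformly (`IsTameFamily.tendsto_seminorm`). For the sum over `J₂`, whose sets avoid a
ball around the origin, the vanishing of `η` is not needed, and that sum converges in `𝒮'`.

For the sum over `J₁`, a general test function `ψ` is replaced by `ψ - ∑ L_e(ψ) τ_e`, where the
`L_e` are the moments of degree at most `M = κ m + m` and the `τ_e` are fixed Schwartz functions
chosen such that all these moments of the difference vanish (`exists_correction`); then the Fourier
transform of the difference vanishes to order `M` at the origin. Each distribution `v` changes under
this replacement by the functional `ψ ↦ ∑ v(τ_e) L_e(ψ)`, which is a polynomial of degree at most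
`M` (`exists_moment_correction`). These polynomials are the corrections in the second part, and they
disappear in the quotient `𝒮' / 𝒫`.
-/

namespace HomDecomp

/-! ### Families of smooth functions with controlled blow-up at the origin -/

section Blowup

variable {V : Type*} [NormedAddCommGroup V]

/-- The weight `max(1, ‖ξ‖^{-κ})`, which measures the blow-up of one derivative at the origin. -/
noncomputable def blowup (κ : ℕ) (ξ : V) : ℝ := max 1 (‖ξ‖ ^ κ)⁻¹

theorem one_le_blowup (κ : ℕ) (ξ : V) : 1 ≤ blowup κ ξ := le_max_left _ _

theorem blowup_pos (κ : ℕ) (ξ : V) : 0 < blowup κ ξ := zero_lt_one.trans_le (one_le_blowup κ ξ)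

theorem blowup_of_one_le {κ : ℕ} {ξ : V} (h : 1 ≤ ‖ξ‖) : blowup κ ξ = 1 :=
  max_eq_left (inv_le_one_of_one_le₀ (one_le_pow₀ h))

theorem blowup_of_le_one {κ : ℕ} {ξ : V} (h0 : ξ ≠ 0) (h : ‖ξ‖ ≤ 1) :
    blowup κ ξ = (‖ξ‖ ^ κ)⁻¹ :=
  max_eq_right ((one_le_inv₀ (by positivity)).mpr (pow_le_one₀ (norm_nonneg _) h))

theorem blowup_le_of_le {κ : ℕ} {ξ : V} {c : ℝ} (hc : 0 < c) (h : c ≤ ‖ξ‖) :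
    blowup κ ξ ≤ max 1 (c ^ κ)⁻¹ := by
  unfold blowup
  gcongr

end Blowup

section PartialSum

variable {J V F : Type*} [NormedAddCommGroup F]

/-- The partial sum `∑_{j ∈ I} θ j` of a family of functions. -/
noncomputable def partialSum (θ : J → V → F) (I : Set J) (ξ : V) : F :=
  ∑' j, I.indicator (fun j => θ j ξ) j

theorem partialSum_univ (θ : J → V → F) (ξ : V) : partialSum θ Set.univ ξ = ∑' j, θ j ξ := by
  simp only [partialSum, Set.indicator_univ]

theorem partialSum_eq_sum {θ : J → V → F} {I : Set J} [DecidablePred (· ∈ I)] {ξ : V}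
    {s : Finset J} (hs : ∀ j ∉ s, θ j ξ = 0) :
    partialSum θ I ξ = ∑ j ∈ s with j ∈ I, θ j ξ := by
  unfold partialSum
  rw [tsum_eq_sum (s := s), Finset.sum_filter]
  · exact Finset.sum_congr rfl fun j _ => by rw [Set.indicator_apply]
  · intro j hj
    rw [Set.indicator_apply, hs j hj, ite_self]

theorem partialSum_eq_zero {θ : J → V → F} {I : Set J} {ξ : V} (h : ∀ j ∈ I, θ j ξ = 0) :
    partialSum θ I ξ = 0 := by
  have : (I.indicator fun j => θ j ξ) = 0 := by
    funext j
    by_cases hj : j ∈ I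
    · simp [hj, h j hj]
    · simp [hj]
  simp [partialSum, this]

end PartialSum

section TameFamily

variable {J V F : Type*} [NormedAddCommGroup V] [NormedSpace ℝ V]
  [NormedAddCommGroup F] [NormedSpace ℝ F]

/-- A family of smooth functions `θ j` supported in sets `U j`, such that near every `ξ ≠ 0` at most
`N` of the sets `U j` are met, and such that the `i`-th derivatives grow at most like
`max(1, ‖ξ‖^{-κ})^i`, uniformly in `j`. -/
structure IsTameFamily (κ : ℕ) (U : J → Set V) (θ : J → V → F) : Prop where
  smooth : ∀ j, ContDiff ℝ ∞ (θ j)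
  tsupport_subset : ∀ j, tsupport (θ j) ⊆ U j
  overlap : ∃ N : ℕ, ∀ ξ : V, ξ ≠ 0 → ∃ O ∈ 𝓝 ξ, {k | (U k ∩ O).Nonempty}.encard ≤ N
  bound : ∀ i : ℕ, ∃ B : ℝ, ∀ j ξ, ξ ≠ 0 → ‖iteratedFDeriv ℝ i (θ j) ξ‖ ≤ B * blowup κ ξ ^ i

/-- The iterated derivatives of a function vanish outside its topological support. -/
theorem iteratedFDeriv_eq_zero_of_notMem_tsupport {f : V → F} {ξ : V} (h : ξ ∉ tsupport f)
    (i : ℕ) : iteratedFDeriv ℝ i f ξ = 0 := by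
  by_contra h'
  exact h (support_iteratedFDeriv_subset (𝕜 := ℝ) i h')

namespace IsTameFamily

variable {κ : ℕ} {U : J → Set V} {θ : J → V → F}

/-- Away from the origin, all partial sums are locally sums over subsets of a single finite set,
whose cardinality is bounded uniformly. -/
theorem exists_finset (hθ : IsTameFamily κ U θ) : ∃ N : ℕ, ∀ ξ : V, ξ ≠ 0 →
    ∃ s : Finset J, s.card ≤ N ∧ ∀ᶠ ζ in 𝓝 ξ, ∀ j ∉ s, θ j ζ = 0 := by
  obtain ⟨N, hN⟩ := hθ.overlap
  refine ⟨N, fun ξ hξ => ?_⟩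
  obtain ⟨O, hO, hcard⟩ := hN ξ hξ
  have hfin : {k | (U k ∩ O).Nonempty}.Finite := Set.finite_of_encard_le_coe hcard
  refine ⟨hfin.toFinset, ?_, ?_⟩
  · rw [hfin.encard_eq_coe_toFinset_card] at hcard
    exact_mod_cast hcard
  · filter_upwards [hO] with ζ hζ j hj
    by_contra h
    exact hj (hfin.mem_toFinset.mpr ⟨ζ, hθ.tsupport_subset j (subset_tsupport _ h), hζ⟩)

theorem contDiffOn_partialSum (hθ : IsTameFamily κ U θ) (I : Set J) :
    ContDiffOn ℝ ∞ (partialSum θ I) {0}ᶜ := by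
  classical
  obtain ⟨N, hN⟩ := hθ.exists_finset
  intro ξ hξ
  obtain ⟨s, -, hs⟩ := hN ξ hξ
  refine ContDiffAt.contDiffWithinAt ?_
  have h : partialSum θ I =ᶠ[𝓝 ξ] fun ζ => ∑ j ∈ s with j ∈ I, θ j ζ := by
    filter_upwards [hs] with ζ hζ using partialSum_eq_sum hζ
  exact (ContDiff.sum fun j _ => hθ.smooth j).contDiffAt.congr_of_eventuallyEq h

/-- The derivatives of partial sums satisfy the same bounds as those of the single functions. -/
theorem bound_partialSum (hθ : IsTameFamily κ U θ) (i : ℕ) :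
    ∃ B : ℝ, 0 ≤ B ∧ ∀ (I : Set J) (ξ : V), ξ ≠ 0 →
      ‖iteratedFDeriv ℝ i (partialSum θ I) ξ‖ ≤ B * blowup κ ξ ^ i := by
  classical
  obtain ⟨N, hN⟩ := hθ.exists_finset
  obtain ⟨B, hB⟩ := hθ.bound i
  refine ⟨N * |B|, by positivity, fun I ξ hξ => ?_⟩
  obtain ⟨s, hcard, hs⟩ := hN ξ hξ
  have h : partialSum θ I =ᶠ[𝓝 ξ] fun ζ => ∑ j ∈ s with j ∈ I, θ j ζ := by
    filter_upwards [hs] with ζ hζ using partialSum_eq_sum hζ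
  have hb := blowup_pos κ ξ
  rw [(h.iteratedFDeriv ℝ i).eq_of_nhds,
    iteratedFDeriv_fun_sum_apply fun j _ => ((hθ.smooth j).of_le (mod_cast le_top)).contDiffAt]
  calc ‖∑ j ∈ s with j ∈ I, iteratedFDeriv ℝ i (θ j) ξ‖
      ≤ (s.filter (· ∈ I)).card • (|B| * blowup κ ξ ^ i) := by
        refine norm_sum_le_of_le _ (fun j _ => ?_) |>.trans (Finset.sum_const _).le
        exact (hB j ξ hξ).trans (by gcongr; exact le_abs_self B)
    _ ≤ N * |B| * blowup κ ξ ^ i := by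
        rw [nsmul_eq_mul, mul_assoc]
        gcongr
        exact (Finset.card_filter_le _ _).trans hcard

/-- A partial sum has vanishing derivatives at the points that lie in none of the sets involved. -/
theorem iteratedFDeriv_partialSum_eq_zero (hθ : IsTameFamily κ U θ) {I : Set J} {ξ : V}
    (hξ : ξ ≠ 0) (h : ∀ j ∈ I, ξ ∉ U j) (i : ℕ) : iteratedFDeriv ℝ i (partialSum θ I) ξ = 0 := by
  classical
  obtain ⟨N, hN⟩ := hθ.exists_finset
  obtain ⟨s, -, hs⟩ := hN ξ hξ
  have h' : partialSum θ I =ᶠ[𝓝 ξ] fun ζ => ∑ j ∈ s with j ∈ I, θ j ζ := by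
    filter_upwards [hs] with ζ hζ using partialSum_eq_sum hζ
  rw [(h'.iteratedFDeriv ℝ i).eq_of_nhds,
    iteratedFDeriv_fun_sum_apply fun j _ => ((hθ.smooth j).of_le (mod_cast le_top)).contDiffAt]
  refine Finset.sum_eq_zero fun j hj => ?_
  exact iteratedFDeriv_eq_zero_of_notMem_tsupport
    (fun hmem => h j (Finset.mem_filter.mp hj).2 (hθ.tsupport_subset j hmem)) i

/-- Removing finitely many functions from a partial sum. -/
theorem partialSum_sub_sum (hθ : IsTameFamily κ U θ) {I : Set J} {s : Finset J} (hs : ↑s ⊆ I)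
    {ξ : V} (hξ : ξ ≠ 0) :
    partialSum θ I ξ - ∑ j ∈ s, θ j ξ = partialSum θ (I \ s) ξ := by
  classical
  obtain ⟨N, hN⟩ := hθ.exists_finset
  obtain ⟨t, -, ht⟩ := hN ξ hξ
  have ht' : ∀ j ∉ t ∪ s, θ j ξ = 0 := fun j hj =>
    ht.self_of_nhds j fun h => hj (Finset.mem_union_left _ h)
  rw [partialSum_eq_sum ht', partialSum_eq_sum ht', sub_eq_iff_eq_add]
  have hsub : s ⊆ (t ∪ s).filter (· ∈ I) := fun j hj =>
    Finset.mem_filter.mpr ⟨Finset.mem_union_right _ hj, hs hj⟩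
  rw [← Finset.sum_sdiff hsub]
  congr 1
  refine Finset.sum_congr ?_ fun _ _ => rfl
  ext j
  simp
  tauto

/-- Only finitely many of the sets `U j` meet a compact set that does not contain the origin. -/
theorem finite_inter_compact (hθ : IsTameFamily κ U θ) {K : Set V} (hK : IsCompact K)
    (h0 : (0 : V) ∉ K) : {k | (U k ∩ K).Nonempty}.Finite := by
  obtain ⟨N, hN⟩ := hθ.overlap
  choose! O hO hcard using hN
  have hne : ∀ ξ ∈ K, ξ ≠ 0 := fun ξ hξ h => h0 (h ▸ hξ)
  obtain ⟨t, htK, ht⟩ := hK.elim_nhds_subcover O fun ξ hξ => hO ξ (hne ξ hξ)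
  refine (t.finite_toSet.biUnion fun ξ hξ =>
    Set.finite_of_encard_le_coe (hcard ξ (hne ξ (htK ξ hξ)))).subset ?_
  rintro k ⟨ζ, hζU, hζK⟩
  obtain ⟨ξ, hξ, hζξ⟩ := Set.mem_iUnion₂.mp (ht hζK)
  exact Set.mem_biUnion hξ ⟨ζ, hζU, hζξ⟩

/-- A partial sum over sets that avoid a ball around the origin has temperate growth. -/
theorem hasTemperateGrowth_partialSum (hθ : IsTameFamily κ U θ) {I : Set J} {c : ℝ} (hc : 0 < c)
    (hI : ∀ j ∈ I, ∀ ξ ∈ U j, c ≤ ‖ξ‖) : (partialSum θ I).HasTemperateGrowth := by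
  have hzero : ∀ ξ : V, ‖ξ‖ < c → partialSum θ I ξ = 0 := fun ξ hξ => by
    refine partialSum_eq_zero fun j hj => ?_
    by_contra h
    exact absurd (hI j hj ξ (hθ.tsupport_subset j (subset_tsupport _ h))) (not_le.mpr hξ)
  have hev : ∀ ξ : V, ‖ξ‖ < c → partialSum θ I =ᶠ[𝓝 ξ] fun _ => 0 := fun ξ hξ => by
    filter_upwards [(isOpen_lt continuous_norm continuous_const).mem_nhds hξ] with ζ hζ
      using hzero ζ hζ
  refine ⟨contDiff_iff_contDiffAt.mpr fun ξ => ?_, fun n => ?_⟩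
  · rcases lt_or_ge ‖ξ‖ c with h | h
    · exact contDiffAt_const.congr_of_eventuallyEq (hev ξ h)
    · have hξ : ξ ∈ ({0}ᶜ : Set V) := norm_pos_iff.mp (hc.trans_le h)
      exact (hθ.contDiffOn_partialSum I).contDiffAt (isOpen_compl_singleton.mem_nhds hξ)
  · obtain ⟨B, hB0, hB⟩ := hθ.bound_partialSum n
    refine ⟨0, B * max 1 (c ^ κ)⁻¹ ^ n, fun ξ => ?_⟩
    rw [pow_zero, mul_one]
    rcases lt_or_ge ‖ξ‖ c with h | h
    · rw [((hev ξ h).iteratedFDeriv ℝ n).eq_of_nhds, iteratedFDeriv_fun_zero]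
      simp only [Pi.zero_apply, norm_zero]
      positivity
    · refine (hB I ξ (norm_pos_iff.mp (hc.trans_le h))).trans ?_
      have := blowup_pos κ ξ
      gcongr
      exact blowup_le_of_le hc h

end IsTameFamily

end TameFamily

/-! ### Normalizing a tame family -/

section Quotient

variable {J V : Type*} [NormedAddCommGroup V] [NormedSpace ℝ V]

theorem norm_iteratedFDeriv_inv_le {y : ℝ} (hy : 1 ≤ y) (i : ℕ) :
    ‖iteratedFDeriv ℝ i (fun z : ℝ => z⁻¹) y‖ ≤ i.factorial := by
  rw [norm_iteratedFDeriv_eq_norm_iteratedDeriv, iteratedDeriv_eq_iterate]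
  have h := iter_deriv_inv i y
  change ‖deriv^[i] Inv.inv y‖ ≤ _
  rw [h, norm_mul, norm_mul, norm_pow, norm_neg, norm_one, one_pow, one_mul, norm_zpow,
    Real.norm_natCast, Real.norm_of_nonneg (by linarith)]
  refine mul_le_of_le_one_right (by positivity) ?_
  exact zpow_le_one_of_nonpos₀ hy (by omega)

/-- If `S ≥ 1` has derivatives of order `i ≤ n` bounded by `B i * t ^ i`, then the `n`-th
derivative of `1 / S` is bounded by a multiple of `t ^ n`. -/
theorem exists_bound_iteratedFDeriv_inv (B : ℕ → ℝ) (n : ℕ) :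
    ∃ C : ℝ, 0 ≤ C ∧ ∀ (S : V → ℝ) (s : Set V), IsOpen s → ContDiffOn ℝ ∞ S s →
      (∀ ξ ∈ s, 1 ≤ S ξ) → ∀ ξ ∈ s, ∀ t : ℝ, 0 ≤ t →
      (∀ i ≤ n, ‖iteratedFDeriv ℝ i S ξ‖ ≤ B i * t ^ i) →
      ‖iteratedFDeriv ℝ n (fun ζ => (S ζ)⁻¹) ξ‖ ≤ C * t ^ n := by
  -- The bound for compositions needs `B i ≤ D ^ i` for `i ≥ 1`, so `D ≥ 1` is essential.
  set D : ℝ := 1 + ∑ i ∈ Finset.range (n + 1), |B i| with hD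
  have hsum : 0 ≤ ∑ i ∈ Finset.range (n + 1), |B i| := Finset.sum_nonneg fun _ _ => abs_nonneg _
  have hD1 : 1 ≤ D := by linarith
  refine ⟨n.factorial * n.factorial * D ^ n, by positivity, ?_⟩
  intro S s hs hS hS1 ξ hξ t ht hbound
  have hpos : IsOpen (Set.Ioi (0 : ℝ)) := isOpen_Ioi
  have hmaps : Set.MapsTo S s (Set.Ioi 0) := fun ζ hζ => zero_lt_one.trans_le (hS1 ζ hζ)
  have key := norm_iteratedFDerivWithin_comp_le (𝕜 := ℝ) (g := fun z : ℝ => z⁻¹) (f := S)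
    (n := n) (s := s) (t := Set.Ioi 0) (x := ξ) (N := ∞) (C := n.factorial) (D := D * t)
    (fun z hz => (contDiffAt_inv ℝ (ne_of_gt hz)).contDiffWithinAt) hS (mod_cast le_top)
    hpos.uniqueDiffOn hs.uniqueDiffOn hmaps hξ ?_ ?_
  · rw [iteratedFDerivWithin_of_isOpen n hs hξ] at key
    refine key.trans (le_of_eq ?_)
    rw [mul_pow]
    ring
  · intro i hi
    rw [iteratedFDerivWithin_of_isOpen i hpos (hmaps hξ)]
    refine (norm_iteratedFDeriv_inv_le (hS1 ξ hξ) i).trans ?_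
    exact_mod_cast Nat.factorial_le hi
  · intro i hi1 hi
    rw [iteratedFDerivWithin_of_isOpen i hs hξ, mul_pow]
    refine (hbound i hi).trans ?_
    gcongr
    calc B i ≤ |B i| := le_abs_self _
      _ ≤ ∑ i ∈ Finset.range (n + 1), |B i| :=
        Finset.single_le_sum (f := fun i => |B i|) (fun _ _ => abs_nonneg _)
          (Finset.mem_range.mpr (by omega))
      _ ≤ D := by linarith
      _ ≤ D ^ i := le_self_pow₀ hD1 (by omega)

/-- Dividing a tame family by its sum gives a tame family, if the sum is at least `1` away from the
origin and none of the functions charges the origin. -/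
theorem IsTameFamily.div_partialSum {κ : ℕ} {U : J → Set V} {g : J → V → ℝ}
    (hg : IsTameFamily κ U g) (h0 : ∀ j, (0 : V) ∉ U j)
    (h1 : ∀ ξ : V, ξ ≠ 0 → 1 ≤ partialSum g Set.univ ξ) :
    IsTameFamily κ U fun j ξ => g j ξ / partialSum g Set.univ ξ := by
  have hopen : IsOpen ({0}ᶜ : Set V) := isOpen_compl_singleton
  have hS := hg.contDiffOn_partialSum Set.univ
  have hinv : ContDiffOn ℝ ∞ (fun ξ => (partialSum g Set.univ ξ)⁻¹) {0}ᶜ :=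
    hS.inv fun ξ hξ => (zero_lt_one.trans_le (h1 ξ hξ)).ne'
  have hquot : ∀ j, (fun ξ => g j ξ / partialSum g Set.univ ξ) =
      fun ξ => g j ξ * (partialSum g Set.univ ξ)⁻¹ := fun j => by
    funext ξ; rw [div_eq_mul_inv]
  refine ⟨fun j => contDiff_iff_contDiffAt.mpr fun ξ => ?_, fun j => ?_, hg.overlap, fun n => ?_⟩
  · rw [hquot]
    by_cases hξ : ξ = 0
    · subst hξ
      have hev : (fun ζ => g j ζ * (partialSum g Set.univ ζ)⁻¹) =ᶠ[𝓝 0] fun _ => 0 := by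
        have hmem : (0 : V) ∉ tsupport (g j) := fun h => h0 j (hg.tsupport_subset j h)
        filter_upwards [notMem_tsupport_iff_eventuallyEq.mp hmem] with ζ hζ
        rw [hζ, Pi.zero_apply, zero_mul]
      exact contDiffAt_const.congr_of_eventuallyEq hev
    · exact (hg.smooth j).contDiffAt.mul (hinv.contDiffAt (hopen.mem_nhds hξ))
  · rw [hquot]
    exact (tsupport_mul_subset_left).trans (hg.tsupport_subset j)
  · choose B hB0 hB using hg.bound_partialSum
    choose Bg hBg using hg.bound
    choose C hC0 hC using exists_bound_iteratedFDeriv_inv (V := V) B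
    refine ⟨∑ i ∈ Finset.range (n + 1), (n.choose i : ℝ) * |Bg i| * C (n - i), fun j ξ hξ => ?_⟩
    have hb := blowup_pos κ ξ
    rw [hquot]
    have hprod := norm_iteratedFDerivWithin_mul_le (𝕜 := ℝ) (N := ∞) (n := n)
      (hg.smooth j).contDiffOn hinv hopen.uniqueDiffOn hξ (mod_cast le_top)
    rw [iteratedFDerivWithin_of_isOpen n hopen hξ] at hprod
    refine hprod.trans ?_
    rw [Finset.sum_mul]
    refine Finset.sum_le_sum fun i hi => ?_
    rw [iteratedFDerivWithin_of_isOpen i hopen hξ, iteratedFDerivWithin_of_isOpen (n - i) hopen hξ]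
    have hin : i ≤ n := by simpa [Nat.lt_succ_iff] using hi
    have e : blowup κ ξ ^ n = blowup κ ξ ^ i * blowup κ ξ ^ (n - i) := by
      rw [← pow_add, Nat.add_sub_cancel' hin]
    have h2 := hC (n - i) (partialSum g Set.univ) {0}ᶜ hopen hS (fun ξ hξ => h1 ξ hξ) ξ hξ
      (blowup κ ξ) hb.le fun k _ => hB k Set.univ ξ hξ
    have h3 : ‖iteratedFDeriv ℝ i (g j) ξ‖ ≤ |Bg i| * blowup κ ξ ^ i :=
      (hBg i j ξ hξ).trans (by gcongr; exact le_abs_self _)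
    calc (n.choose i : ℝ) * ‖iteratedFDeriv ℝ i (g j) ξ‖ *
          ‖iteratedFDeriv ℝ (n - i) (fun ξ => (partialSum g Set.univ ξ)⁻¹) ξ‖
        ≤ (n.choose i : ℝ) * (|Bg i| * blowup κ ξ ^ i) * (C (n - i) * blowup κ ξ ^ (n - i)) := by
          gcongr
      _ = _ := by rw [e]; ring

end Quotient

/-! ### Convergence of multiplier sums against functionals of finite order -/

section Multiplier

variable {J V : Type*} [NormedAddCommGroup V] [NormedSpace ℝ V]

/-- The Leibniz bound for the derivatives of `(∑_{j ∈ I'} θ j) η`. The hypothesis on `η` says that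
`η` vanishes at the origin to an order that compensates the blow-up of `m` derivatives of the `θ j`;
it is void at the origin if the sets `U j` with `j ∈ I` stay away from it. -/
theorem IsTameFamily.exists_bound_leibniz {κ : ℕ} {U : J → Set V} {θ : J → V → ℂ}
    (hθ : IsTameFamily κ U θ) {I : Set J} (η : 𝓢(V, ℂ)) {m : ℕ}
    (hη : ∃ K : ℝ, ∀ i ≤ m, ∀ j ∈ I, ∀ ξ ∈ U j, ‖ξ‖ ≤ 1 →
      ‖iteratedFDeriv ℝ i η ξ‖ ≤ K * ‖ξ‖ ^ (κ * m + 1)) (k : ℕ) {n : ℕ} (hn : n ≤ m) :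
    ∃ C : ℝ, 0 ≤ C ∧ ∀ I' ⊆ I, ∀ ξ : V, ξ ≠ 0 →
      ‖ξ‖ ^ k * ∑ i ∈ Finset.range (n + 1), (n.choose i : ℝ) *
        ‖iteratedFDeriv ℝ i (partialSum θ I') ξ‖ * ‖iteratedFDeriv ℝ (n - i) η ξ‖ ≤
        C * min ‖ξ‖ ‖ξ‖⁻¹ := by
  obtain ⟨K, hK⟩ := hη
  choose B hB0 hB using hθ.bound_partialSum
  let sem : ℕ → ℝ := fun i => SchwartzMap.seminorm ℝ (k + 1) i η
  have hsem : ∀ i, 0 ≤ sem i := fun i => apply_nonneg _ _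
  refine ⟨∑ i ∈ Finset.range (n + 1), (n.choose i : ℝ) * B i * (|K| + sem (n - i)),
    Finset.sum_nonneg fun i _ => ?_, fun I' hI' ξ hξ => ?_⟩
  · have := hB0 i
    have := hsem (n - i)
    positivity
  have hpos : 0 < ‖ξ‖ := norm_pos_iff.mpr hξ
  rw [Finset.mul_sum, Finset.sum_mul]
  refine Finset.sum_le_sum fun i hi => ?_
  have hin : i ≤ n := by simpa [Nat.lt_succ_iff] using hi
  have hmin : 0 ≤ min ‖ξ‖ ‖ξ‖⁻¹ := by positivity
  have hBi := hB0 i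
  have hsi := hsem (n - i)
  by_cases hmem : ∃ j ∈ I', ξ ∈ U j
  swap
  · push Not at hmem
    rw [hθ.iteratedFDeriv_partialSum_eq_zero hξ hmem i]
    simp only [norm_zero, mul_zero, zero_mul]
    positivity
  obtain ⟨j, hj, hξj⟩ := hmem
  have hbound := hB i I' ξ hξ
  have hb := blowup_pos κ ξ
  -- Near the origin the power `κ m + 1` absorbs the blow-up and leaves a factor `‖ξ‖`; far away one
  -- more power of the Schwartz decay of `η` is spent on the factor `‖ξ‖⁻¹`.
  have key : ‖ξ‖ ^ k * (blowup κ ξ ^ i * ‖iteratedFDeriv ℝ (n - i) η ξ‖) ≤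
      (|K| + sem (n - i)) * min ‖ξ‖ ‖ξ‖⁻¹ := by
    rcases le_total ‖ξ‖ 1 with h | h
    · rw [min_eq_left (h.trans ((one_le_inv₀ hpos).mpr h))]
      have h1 : ‖iteratedFDeriv ℝ (n - i) η ξ‖ ≤ |K| * ‖ξ‖ ^ (κ * m + 1) :=
        (hK (n - i) (by omega) j (hI' hj) ξ hξj h).trans (by gcongr; exact le_abs_self K)
      have h2 : blowup κ ξ ^ i ≤ (‖ξ‖ ^ (κ * m))⁻¹ := by
        refine (pow_le_pow_right₀ (one_le_blowup κ ξ) (hin.trans hn)).trans (le_of_eq ?_)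
        rw [blowup_of_le_one hξ h, inv_pow, pow_mul]
      calc ‖ξ‖ ^ k * (blowup κ ξ ^ i * ‖iteratedFDeriv ℝ (n - i) η ξ‖)
          ≤ 1 * ((‖ξ‖ ^ (κ * m))⁻¹ * (|K| * ‖ξ‖ ^ (κ * m + 1))) := by
            gcongr
            exact pow_le_one₀ hpos.le h
        _ = |K| * ‖ξ‖ := by
            rw [pow_succ]
            field_simp
        _ ≤ (|K| + sem (n - i)) * ‖ξ‖ := by gcongr; linarith
    · rw [min_eq_right ((inv_le_one_of_one_le₀ h).trans h), blowup_of_one_le h, one_pow, one_mul]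
      have h1 := SchwartzMap.le_seminorm ℝ (k + 1) (n - i) η ξ
      calc ‖ξ‖ ^ k * ‖iteratedFDeriv ℝ (n - i) η ξ‖
          = (‖ξ‖ ^ (k + 1) * ‖iteratedFDeriv ℝ (n - i) η ξ‖) * ‖ξ‖⁻¹ := by
            rw [pow_succ]; field_simp
        _ ≤ sem (n - i) * ‖ξ‖⁻¹ := by gcongr
        _ ≤ (|K| + sem (n - i)) * ‖ξ‖⁻¹ := by gcongr; linarith [abs_nonneg K]
  calc ‖ξ‖ ^ k * ((n.choose i : ℝ) * ‖iteratedFDeriv ℝ i (partialSum θ I') ξ‖ *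
        ‖iteratedFDeriv ℝ (n - i) η ξ‖)
      ≤ ‖ξ‖ ^ k * ((n.choose i : ℝ) * (B i * blowup κ ξ ^ i) *
        ‖iteratedFDeriv ℝ (n - i) η ξ‖) := by gcongr
    _ = (n.choose i : ℝ) * B i *
        (‖ξ‖ ^ k * (blowup κ ξ ^ i * ‖iteratedFDeriv ℝ (n - i) η ξ‖)) := by ring
    _ ≤ (n.choose i : ℝ) * B i * ((|K| + sem (n - i)) * min ‖ξ‖ ‖ξ‖⁻¹) := by gcongr
    _ = _ := by ring

/-- A bound on a weighted derivative of a Schwartz function extends from `ξ ≠ 0` to the origin. -/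
theorem seminorm_le_of_forall_ne_zero [Nontrivial V] (X : 𝓢(V, ℂ)) (k n : ℕ) {M : ℝ} (hM : 0 ≤ M)
    (h : ∀ ξ : V, ξ ≠ 0 → ‖ξ‖ ^ k * ‖iteratedFDeriv ℝ n X ξ‖ ≤ M) :
    SchwartzMap.seminorm ℂ k n X ≤ M := by
  refine SchwartzMap.seminorm_le_bound ℂ k n X hM fun ξ => ?_
  have hcont : Continuous fun ξ : V => ‖ξ‖ ^ k * ‖iteratedFDeriv ℝ n X ξ‖ :=
    (continuous_norm.pow k).mul
      ((X.smooth ⊤).continuous_iteratedFDeriv (mod_cast le_top)).norm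
  have hdense : Dense ({0}ᶜ : Set V) := by
    have := Module.punctured_nhds_neBot ℝ V 0
    exact dense_compl_singleton 0
  exact (isClosed_le hcont continuous_const).closure_subset_iff.mpr (fun ξ hξ => h ξ hξ)
    (hdense ξ)

variable [FiniteDimensional ℝ V] [Nontrivial V]

/-- Let `W` be a smooth extension to the origin of `∑_{j ∈ I} θ j`, and let `η` vanish to high order
at the origin where the `θ j` with `j ∈ I` are supported. Then `∑_{j ∈ F} θ j η` converges to `W η`
in each Schwartz seminorm with at most `m` derivatives, as the finite sets `F ⊆ I` increase to `I`:
the `n`-th derivative of the difference at `ξ` is `O(min(‖ξ‖, 1 / ‖ξ‖))` uniformly in `F`, and in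
each annulus it vanishes as soon as `F` contains the finitely many `j ∈ I` whose sets meet it. -/
theorem IsTameFamily.tendsto_seminorm {κ : ℕ} {U : J → Set V} {θ : J → 𝓢(V, ℂ)}
    (hθ : IsTameFamily κ U fun j => ⇑(θ j)) {I : Set J} {W : V → ℂ} (hW : W.HasTemperateGrowth)
    (hWI : ∀ ξ : V, ξ ≠ 0 → W ξ = partialSum (fun j => ⇑(θ j)) I ξ) (η : 𝓢(V, ℂ)) {m : ℕ}
    (hη : ∃ K : ℝ, ∀ i ≤ m, ∀ j ∈ I, ∀ ξ ∈ U j, ‖ξ‖ ≤ 1 →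
      ‖iteratedFDeriv ℝ i η ξ‖ ≤ K * ‖ξ‖ ^ (κ * m + 1))
    {α : Type*} {l : Filter α} {F : α → Finset J} (hFI : ∀ x, ↑(F x) ⊆ I)
    (hF : ∀ j ∈ I, ∀ᶠ x in l, j ∈ F x) (k : ℕ) {n : ℕ} (hn : n ≤ m) {ε : ℝ} (hε : 0 < ε) :
    ∀ᶠ x in l, SchwartzMap.seminorm ℂ k n (SchwartzMap.smulLeftCLM ℂ W η -
      ∑ j ∈ F x, SchwartzMap.smulLeftCLM ℂ (θ j) η) ≤ ε := by
  have : ProperSpace V := FiniteDimensional.proper_real V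
  obtain ⟨C, hC0, hC⟩ := hθ.exists_bound_leibniz η hη k hn
  set ε' : ℝ := ε / (C + 1) with hε'
  have hε'pos : 0 < ε' := by positivity
  have hCε : C * ε' ≤ ε := by
    rw [hε', ← mul_div_assoc, div_le_iff₀ (by positivity)]
    nlinarith
  -- Outside the annulus `A` the Leibniz bound is at most `C ε' ≤ ε`.
  set A : Set V := {ξ | ε' ≤ ‖ξ‖ ∧ ‖ξ‖ ≤ ε'⁻¹} with hA
  have hAc : IsCompact A := by
    refine (isCompact_closedBall (0 : V) ε'⁻¹).of_isClosed_subset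
      ((isClosed_le continuous_const continuous_norm).inter
        (isClosed_le continuous_norm continuous_const)) fun ξ hξ => ?_
    simpa using hξ.2
  have hA0 : (0 : V) ∉ A := fun h => absurd h.1 (by simpa using hε'pos)
  have hfin := hθ.finite_inter_compact hAc hA0
  have hev : ∀ᶠ x in l, ∀ j ∈ {j | (U j ∩ A).Nonempty} ∩ I, j ∈ F x :=
    (hfin.inter_of_left I).eventually_all.mpr fun j hj => hF j hj.2
  filter_upwards [hev] with x hx
  refine seminorm_le_of_forall_ne_zero _ k n hε.le fun ξ hξ => ?_
  have hopen : IsOpen ({0}ᶜ : Set V) := isOpen_compl_singleton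
  have heq : ⇑(SchwartzMap.smulLeftCLM ℂ W η - ∑ j ∈ F x, SchwartzMap.smulLeftCLM ℂ (θ j) η)
      =ᶠ[𝓝 ξ] fun ζ => partialSum (fun j => ⇑(θ j)) (I \ F x) ζ * η ζ := by
    filter_upwards [hopen.mem_nhds hξ] with ζ hζ
    rw [← hθ.partialSum_sub_sum (hFI x) hζ, sub_mul, Finset.sum_mul, ← hWI ζ hζ]
    simp [SchwartzMap.smulLeftCLM_apply_apply hW,
      SchwartzMap.smulLeftCLM_apply_apply (θ _).hasTemperateGrowth]
  rw [(heq.iteratedFDeriv ℝ n).eq_of_nhds]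
  have hprod := norm_iteratedFDerivWithin_mul_le (𝕜 := ℝ) (N := ∞) (n := n)
    (hθ.contDiffOn_partialSum (I \ F x)) (η.smooth ⊤).contDiffOn hopen.uniqueDiffOn hξ
    (mod_cast le_top)
  rw [iteratedFDerivWithin_of_isOpen n hopen hξ] at hprod
  replace hprod := hprod.trans_eq (Finset.sum_congr rfl fun i _ => by
    rw [iteratedFDerivWithin_of_isOpen i hopen hξ, iteratedFDerivWithin_of_isOpen (n - i) hopen hξ])
  by_cases hξA : ξ ∈ A
  · have hzero : ∀ i, iteratedFDeriv ℝ i (partialSum (fun j => ⇑(θ j)) (I \ F x)) ξ = 0 := fun i =>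
      hθ.iteratedFDeriv_partialSum_eq_zero hξ
        (fun j hj hmem => hj.2 (hx j ⟨⟨ξ, hmem, hξA⟩, hj.1⟩)) i
    have : ‖iteratedFDeriv ℝ n
        (fun ζ => partialSum (fun j => ⇑(θ j)) (I \ F x) ζ * η ζ) ξ‖ ≤ 0 := by
      simpa [hzero] using hprod
    rw [le_antisymm this (norm_nonneg _), mul_zero]
    exact hε.le
  · have hmin : min ‖ξ‖ ‖ξ‖⁻¹ ≤ ε' := by
      by_cases h : ε' ≤ ‖ξ‖
      · have : ε'⁻¹ < ‖ξ‖ := not_le.mp fun h' => hξA ⟨h, h'⟩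
        exact (min_le_right _ _).trans (inv_le_of_inv_le₀ hε'pos this.le)
      · exact (min_le_left _ _).trans (not_le.mp h).le
    calc _ ≤ _ := by gcongr
      _ ≤ C * min ‖ξ‖ ‖ξ‖⁻¹ := hC (I \ F x) Set.sdiff_subset ξ hξ
      _ ≤ C * ε' := by gcongr
      _ ≤ ε := hCε

/-- Under the assumptions of `IsTameFamily.tendsto_seminorm`, a functional that is bounded by
seminorms with at most `m` derivatives satisfies `∑_{j ∈ F} u (θ j η) → u (W η)`. -/
theorem IsTameFamily.tendsto_apply {κ : ℕ} {U : J → Set V} {θ : J → 𝓢(V, ℂ)}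
    (hθ : IsTameFamily κ U fun j => ⇑(θ j)) {I : Set J} {W : V → ℂ} (hW : W.HasTemperateGrowth)
    (hWI : ∀ ξ : V, ξ ≠ 0 → W ξ = partialSum (fun j => ⇑(θ j)) I ξ) (η : 𝓢(V, ℂ)) {m : ℕ}
    (hη : ∃ K : ℝ, ∀ i ≤ m, ∀ j ∈ I, ∀ ξ ∈ U j, ‖ξ‖ ≤ 1 →
      ‖iteratedFDeriv ℝ i η ξ‖ ≤ K * ‖ξ‖ ^ (κ * m + 1))
    {α : Type*} {l : Filter α} {F : α → Finset J} (hFI : ∀ x, ↑(F x) ⊆ I)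
    (hF : ∀ j ∈ I, ∀ᶠ x in l, j ∈ F x) (u : 𝓢(V, ℂ) →ₗ[ℂ] ℂ) {b : ℕ} {C : ℝ}
    (hu : ∀ ψ, ‖u ψ‖ ≤ C * ((Finset.Iic (b, m)).sup (schwartzSeminormFamily ℂ V ℂ)) ψ) :
    Tendsto (fun x => ∑ j ∈ F x, u (SchwartzMap.smulLeftCLM ℂ (θ j) η)) l
      (𝓝 (u (SchwartzMap.smulLeftCLM ℂ W η))) := by
  refine Metric.tendsto_nhds.mpr fun ε hε => ?_
  have hε' : 0 < ε / (2 * (|C| + 1)) := by positivity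
  have hev : ∀ᶠ x in l, ∀ q ∈ Finset.Iic (b, m), SchwartzMap.seminorm ℂ q.1 q.2
      (SchwartzMap.smulLeftCLM ℂ W η - ∑ j ∈ F x, SchwartzMap.smulLeftCLM ℂ (θ j) η) ≤
        ε / (2 * (|C| + 1)) :=
    (Filter.eventually_all_finset _).mpr fun q hq =>
      hθ.tendsto_seminorm hW hWI η hη hFI hF q.1 (Prod.mk_le_mk.mp (Finset.mem_Iic.mp hq)).2 hε'
  filter_upwards [hev] with x hx
  have hsup := Seminorm.finset_sup_apply_le (p := schwartzSeminormFamily ℂ V ℂ) hε'.le hx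
  rw [dist_comm, dist_eq_norm, ← map_sum, ← map_sub]
  calc _ ≤ _ := hu _
    _ ≤ |C| * (ε / (2 * (|C| + 1))) :=
      mul_le_mul (le_abs_self C) hsup (apply_nonneg _ _) (abs_nonneg C)
    _ < ε := by
      rw [← mul_div_assoc, div_lt_iff₀ (by positivity)]
      nlinarith [abs_nonneg C]

end Multiplier

/-! ### Anisotropic dilations and lower bounds for the regulation function -/

section Anisotropic

variable {d : ℕ} {a : Fin d → ℝ}

theorem act_add (M : Matrix (Fin d) (Fin d) ℝ) (ξ ζ : E d) : act M (ξ + ζ) = act M ξ + act M ζ :=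
  map_add (Matrix.toLpLin 2 2 M) ξ ζ

theorem act_act (M N : Matrix (Fin d) (Fin d) ℝ) (ξ : E d) : act M (act N ξ) = act (M * N) ξ := by
  simp [act, Matrix.toLpLin_apply, Matrix.mulVec_mulVec]

theorem act_one (ξ : E d) : act (1 : Matrix (Fin d) (Fin d) ℝ) ξ = ξ := by
  simp [act]

theorem dilation_mul_dilation_inv (a : Fin d → ℝ) {t : ℝ} (ht : 0 < t) :
    dilation a t * dilation a t⁻¹ = 1 := by
  rw [dilation, dilation, Matrix.diagonal_mul_diagonal, ← Matrix.diagonal_one]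
  congr 1
  funext i
  rw [Real.inv_rpow ht.le, mul_inv_cancel₀ (Real.rpow_pos_of_pos ht _).ne']

theorem inv_dilation (a : Fin d → ℝ) {t : ℝ} (ht : 0 < t) :
    (dilation a t)⁻¹ = dilation a t⁻¹ :=
  Matrix.inv_eq_right_inv (dilation_mul_dilation_inv a ht)

theorem norm_act_dilation_le {s c : ℝ} (hs : 0 ≤ s) (hc : 0 ≤ c) (h : ∀ i, s ^ a i ≤ c) (ξ : E d) :
    ‖act (dilation a s) ξ‖ ≤ c * ‖ξ‖ := by
  refine (sq_le_sq₀ (norm_nonneg _) (by positivity)).mp ?_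
  rw [norm_act_dilation_sq, mul_pow, EuclideanSpace.norm_sq_eq, Finset.mul_sum]
  refine Finset.sum_le_sum fun i _ => ?_
  rw [mul_pow, Real.norm_eq_abs, sq_abs]
  have := Real.rpow_nonneg hs (a i)
  gcongr
  exact h i

theorem norm_act_dilation_mono (ha : IsAnisotropy a) {s t : ℝ} (hs : 0 ≤ s) (h : s ≤ t) (ξ : E d) :
    ‖act (dilation a s) ξ‖ ≤ ‖act (dilation a t) ξ‖ := by
  refine (sq_le_sq₀ (norm_nonneg _) (norm_nonneg _)).mp ?_
  rw [norm_act_dilation_sq, norm_act_dilation_sq]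
  refine Finset.sum_le_sum fun i _ => ?_
  rw [mul_pow, mul_pow]
  have := Real.rpow_nonneg hs (a i)
  have := Real.rpow_le_rpow hs h (ha.pos i).le
  gcongr

theorem IsAnisotropy.le_dim (ha : IsAnisotropy a) (i : Fin d) : a i ≤ d := by
  rw [← ha.sum_eq]
  exact Finset.single_le_sum (f := a) (fun i _ => (ha.pos i).le) (Finset.mem_univ i)

theorem IsAnisotropy.exists_pos_le (ha : IsAnisotropy a) : ∃ α : ℝ, 0 < α ∧ ∀ i, α ≤ a i := by
  rcases isEmpty_or_nonempty (Fin d) with h | h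
  · exact ⟨1, one_pos, fun i => (h.false i).elim⟩
  · obtain ⟨i₀, hi₀⟩ := Finite.exists_min a
    exact ⟨a i₀, ha.pos i₀, hi₀⟩

theorem anorm_zero (a : Fin d → ℝ) : anorm a (0 : E d) = 0 := by
  have : {t : ℝ | 0 < t ∧ ‖act (dilation a (1 / t)) (0 : E d)‖ = 1} = ∅ := by
    ext t
    have h : act (dilation a (1 / t)) (0 : E d) = 0 := map_zero (Matrix.toLpLin 2 2 _)
    simp only [Set.mem_ofPred_eq, h, norm_zero, zero_ne_one, and_false, Set.mem_empty_iff_false]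
  rw [anorm, this, Real.sInf_empty]

theorem anorm_pos (ha : IsAnisotropy a) {ξ : E d} (hξ : ξ ≠ 0) : 0 < anorm a ξ :=
  ((anorm_eq_iff ha hξ _).mp rfl).1

theorem norm_act_dilation_inv_anorm (ha : IsAnisotropy a) {ξ : E d} (hξ : ξ ≠ 0) :
    ‖act (dilation a (anorm a ξ)⁻¹) ξ‖ = 1 := by
  rw [← one_div]
  exact ((anorm_eq_iff ha hξ _).mp rfl).2

theorem anorm_neg (a : Fin d → ℝ) (ξ : E d) : anorm a (-ξ) = anorm a ξ := by
  have h : ∀ t, act (dilation a (1 / t)) (-ξ) = -act (dilation a (1 / t)) ξ :=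
    fun t => map_neg (Matrix.toLpLin 2 2 _) ξ
  simp only [anorm, h, norm_neg]

theorem norm_act_dilation_inv_le_one (ha : IsAnisotropy a) {ξ : E d} {s : ℝ}
    (h : anorm a ξ ≤ s) : ‖act (dilation a s⁻¹) ξ‖ ≤ 1 := by
  by_cases hξ : ξ = 0
  · have : act (dilation a s⁻¹) ξ = 0 := by rw [hξ]; exact map_zero (Matrix.toLpLin 2 2 _)
    rw [this, norm_zero]
    exact zero_le_one
  · have hpos := anorm_pos ha hξ
    rw [← norm_act_dilation_inv_anorm ha hξ]
    exact norm_act_dilation_mono ha (by have := hpos.trans_le h; positivity)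
      (inv_anti₀ hpos h) ξ

/-- Points of large anisotropic norm have a large Euclidean norm. -/
theorem exists_pos_le_norm_of_le_anorm (ha : IsAnisotropy a) {C : ℝ} (hC : 0 < C) :
    ∃ c : ℝ, 0 < c ∧ ∀ ξ : E d, C ≤ anorm a ξ → c ≤ ‖ξ‖ := by
  set M : ℝ := 1 + ∑ i, C⁻¹ ^ a i with hM
  have hnn : ∀ i, 0 ≤ C⁻¹ ^ a i := fun i => Real.rpow_nonneg (by positivity) _
  have hsum : 0 ≤ ∑ i, C⁻¹ ^ a i := Finset.sum_nonneg fun i _ => hnn i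
  have hMpos : 0 < M := by linarith
  refine ⟨M⁻¹, by positivity, fun ξ hξ => ?_⟩
  have h0 : ξ ≠ 0 := fun h => by
    rw [h, anorm_zero] at hξ
    linarith
  have h1 : 1 ≤ M * ‖ξ‖ := by
    rw [← norm_act_dilation_inv_anorm ha h0]
    refine (norm_act_dilation_mono ha (inv_nonneg.mpr (anorm_pos ha h0).le)
      (inv_anti₀ hC hξ) ξ).trans ?_
    refine norm_act_dilation_le (by positivity) hMpos.le (fun i => ?_) ξ
    have := Finset.single_le_sum (f := fun i => C⁻¹ ^ a i) (fun i _ => hnn i) (Finset.mem_univ i)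
    linarith
  rwa [inv_le_iff_one_le_mul₀' hMpos]

/-- If a quasi-ball around `ξ` does not contain the origin, then all of its points have size at most
comparable to the size of `ξ`. -/
theorem norm_act_dilation_inv_le_two (ha : IsAnisotropy a) {ξ ζ : E d} {t : ℝ} (hξ : ξ ≠ 0)
    (h0 : (0 : E d) ∉ aball a ξ t) (hζ : ζ ∈ aball a ξ t) :
    ‖act (dilation a (anorm a ξ)⁻¹) ζ‖ ≤ 2 := by
  have hle : t ≤ anorm a ξ := by
    simpa [aball, anorm_neg] using h0
  have h1 := norm_act_dilation_inv_le_one ha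
    ((le_of_lt (show anorm a (ζ - ξ) < t from hζ)).trans hle)
  have h2 := norm_act_dilation_inv_anorm ha hξ
  calc ‖act (dilation a (anorm a ξ)⁻¹) ζ‖
      = ‖act (dilation a (anorm a ξ)⁻¹) (ζ - ξ) + act (dilation a (anorm a ξ)⁻¹) ξ‖ := by
        rw [← act_add, sub_add_cancel]
    _ ≤ 1 + 1 := (norm_add_le _ _).trans (add_le_add h1 h2.le)
    _ = 2 := by norm_num

theorem IsHybridRegulation.exists_lower_bound {r : ℝ} {h : E d → ℝ} (ha : IsAnisotropy a)
    (hh : IsHybridRegulation a r h) :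
    ∃ c : ℝ, 0 < c ∧ ∀ ξ : E d, ξ ≠ 0 → c * min 1 (anorm a ξ ^ r) ≤ h ξ := by
  obtain ⟨ρ, h₁, h₂, ⟨-, hρ01, hρ1, hρ0⟩, -, -, -, -, ⟨c₀, c₁, hc₀, -, hlow⟩,
    ⟨c₂, c₃, hc₂, -, hhigh⟩, hdef⟩ := hh
  refine ⟨min c₀ c₂, lt_min hc₀ hc₂, fun ξ hξ => ?_⟩
  have hpow : 0 ≤ anorm a ξ ^ r := Real.rpow_nonneg (anorm_pos ha hξ).le r
  have hmin : 0 ≤ min 1 (anorm a ξ ^ r) := le_min zero_le_one hpow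
  have H1 : anorm a ξ ≤ 4 / 3 → min c₀ c₂ * min 1 (anorm a ξ ^ r) ≤ h₁ ξ := fun hle =>
    (mul_le_mul (min_le_left _ _) (min_le_right _ _) hmin hc₀.le).trans (hlow ξ ⟨hξ, hle⟩).1
  have H2 : 2 / 3 ≤ anorm a ξ → min c₀ c₂ * min 1 (anorm a ξ ^ r) ≤ h₂ ξ := fun hle =>
    (mul_le_mul (min_le_right _ _) (min_le_left _ _) hmin hc₂.le).trans
      ((mul_one _).le.trans (hhigh ξ ⟨hξ, hle⟩).1)
  rw [hdef ξ hξ]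
  rcases le_or_gt (anorm a ξ) (2 / 3) with h | h
  · rw [hρ1 ξ hξ h, one_mul, sub_self, zero_mul, add_zero]
    exact H1 (by linarith)
  rcases le_or_gt (4 / 3) (anorm a ξ) with h' | h'
  · rw [hρ0 ξ h', zero_mul, zero_add, sub_zero, one_mul]
    exact H2 h.le
  · obtain ⟨h0, h1⟩ := hρ01 ξ hξ
    nlinarith [mul_le_mul_of_nonneg_left (H1 h'.le) h0,
      mul_le_mul_of_nonneg_left (H2 h.le) (sub_nonneg.mpr h1)]

theorem IsHybridRegulation.one_le_exponent {r : ℝ} {h : E d → ℝ} (hh : IsHybridRegulation a r h) :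
    1 ≤ r := by
  obtain ⟨_, _, _, -, -, -, -, hr, -⟩ := hh
  exact hr

theorem IsHybridRegulation.pos {r : ℝ} {h : E d → ℝ} (ha : IsAnisotropy a)
    (hh : IsHybridRegulation a r h) {ξ : E d} (hξ : ξ ≠ 0) : 0 < h ξ := by
  obtain ⟨c, hc, hle⟩ := hh.exists_lower_bound ha
  have := Real.rpow_pos_of_pos (anorm_pos ha hξ) r
  exact lt_of_lt_of_le (by positivity) (hle ξ hξ)

/-- On a quasi-ball `B(ξ, δ h(ξ))` that does not contain the origin, the inverse dilation
`D_a(1 / (δ h(ξ)))` has norm at most of order `max(1, ‖ζ‖^{-κ})` with `κ ≥ r d / min a`. Indeed, if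
`s = |ξ|_a` is small, then `δ h(ξ)` is at least of order `s^r`, and `‖ζ‖` is at most of order
`s^{min a}`. -/
theorem IsHybridRegulation.exists_bound_inv_rpow (ha : IsAnisotropy a) {r : ℝ} {h : E d → ℝ}
    (hh : IsHybridRegulation a r h) {δ : ℝ} (hδ : 0 < δ) {α : ℝ} (hα : 0 < α)
    (hαa : ∀ i, α ≤ a i) {κ : ℕ} (hκ : r * d / α ≤ κ) :
    ∃ K : ℝ, 0 ≤ K ∧ ∀ ξ : E d, ξ ≠ 0 → (0 : E d) ∉ aball a ξ (δ * h ξ) →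
      ∀ ζ ∈ aball a ξ (δ * h ξ), ζ ≠ 0 → ∀ i, (δ * h ξ)⁻¹ ^ a i ≤ K * blowup κ ζ := by
  obtain ⟨c, hc, hlow⟩ := hh.exists_lower_bound ha
  have hr : 0 ≤ r := zero_le_one.trans hh.one_le_exponent
  set q : ℝ := max 1 (δ * c)⁻¹ with hq
  have hq1 : 1 ≤ q := le_max_left _ _
  refine ⟨q ^ (d : ℝ) * 2 ^ κ, by positivity, fun ξ hξ h0 ζ hζ hζ0 i => ?_⟩
  set s := anorm a ξ with hs
  have hspos : 0 < s := anorm_pos ha hξ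
  have hy : 0 < ‖ζ‖ := norm_pos_iff.mpr hζ0
  set σ : ℝ := max 1 s⁻¹ with hσ
  have hσ1 : 1 ≤ σ := le_max_left _ _
  have hσ0 : 0 < σ := by linarith
  have hσr : 1 ≤ σ ^ r := Real.one_le_rpow hσ1 hr
  have ht : 0 < δ * h ξ := mul_pos hδ (hh.pos ha hξ)
  -- `δ h(ξ) ≥ δ c min(1, s^r)`, and `σ^r` is the inverse of `min(1, s^r)`.
  have hinv : (δ * h ξ)⁻¹ ≤ q * σ ^ r := by
    have h1 : δ * c * min 1 (s ^ r) ≤ δ * h ξ := by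
      rw [mul_assoc]; exact mul_le_mul_of_nonneg_left (hlow ξ hξ) hδ.le
    have h2 : 1 ≤ min 1 (s ^ r) * σ ^ r := by
      rcases le_total 1 (s ^ r) with h' | h'
      · rw [min_eq_left h', one_mul]; exact hσr
      · rw [min_eq_right h', ← Real.mul_rpow hspos.le hσ0.le]
        refine Real.one_le_rpow ?_ hr
        calc 1 = s * s⁻¹ := (mul_inv_cancel₀ hspos.ne').symm
          _ ≤ s * σ := by gcongr; exact le_max_right _ _
    have h3 : 1 ≤ (δ * c) * q := by
      calc 1 = (δ * c) * (δ * c)⁻¹ := (mul_inv_cancel₀ (by positivity)).symm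
        _ ≤ _ := by gcongr; exact le_max_right _ _
    rw [inv_le_iff_one_le_mul₀ ht]
    have hm : 0 ≤ min 1 (s ^ r) := le_min zero_le_one (Real.rpow_nonneg hspos.le r)
    calc 1 ≤ ((δ * c) * q) * (min 1 (s ^ r) * σ ^ r) := one_le_mul_of_one_le_of_one_le h3 h2
      _ = q * σ ^ r * (δ * c * min 1 (s ^ r)) := by ring
      _ ≤ q * σ ^ r * (δ * h ξ) := by gcongr
  -- If `s ≤ 1`, then `‖ζ‖ ≤ 2 s^α`, since `D_a(1/s) ζ` has norm at most `2`.
  have hσα : σ ^ α ≤ 2 * max 1 ‖ζ‖⁻¹ := by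
    rcases le_total 1 s with h' | h'
    · have : σ = 1 := max_eq_left (inv_le_one_of_one_le₀ h')
      rw [this, Real.one_rpow]
      linarith [le_max_left 1 ‖ζ‖⁻¹]
    · have hσs : σ = s⁻¹ := max_eq_right ((one_le_inv₀ hspos).mpr h')
      have hsα : 0 < s ^ α := Real.rpow_pos_of_pos hspos α
      have h1 : ‖ζ‖ ≤ s ^ α * 2 := by
        have e : ζ = act (dilation a s) (act (dilation a s⁻¹) ζ) := by
          rw [act_act, dilation_mul_dilation_inv a hspos, act_one]
        calc ‖ζ‖ = ‖act (dilation a s) (act (dilation a s⁻¹) ζ)‖ := by rw [← e]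
          _ ≤ s ^ α * ‖act (dilation a s⁻¹) ζ‖ := norm_act_dilation_le hspos.le hsα.le
              (fun i => Real.rpow_le_rpow_of_exponent_ge hspos h' (hαa i)) _
          _ ≤ s ^ α * 2 := by
              gcongr
              exact norm_act_dilation_inv_le_two ha hξ h0 hζ
      rw [hσs, Real.inv_rpow hspos.le]
      calc (s ^ α)⁻¹ ≤ 2 * ‖ζ‖⁻¹ := by
            rw [inv_le_iff_one_le_mul₀ hsα]
            calc (1 : ℝ) = ‖ζ‖ * ‖ζ‖⁻¹ := (mul_inv_cancel₀ hy.ne').symm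
              _ ≤ s ^ α * 2 * ‖ζ‖⁻¹ := by gcongr
              _ = _ := by ring
        _ ≤ _ := by gcongr; exact le_max_right _ _
  have hbase : 1 ≤ q * σ ^ r := one_le_mul_of_one_le_of_one_le hq1 hσr
  have hblow : max 1 ‖ζ‖⁻¹ ^ κ = blowup κ ζ := by
    rw [blowup, ← inv_pow]
    rcases le_total 1 ‖ζ‖⁻¹ with h' | h'
    · rw [max_eq_right h', max_eq_right (one_le_pow₀ h')]
    · rw [max_eq_left h', max_eq_left (pow_le_one₀ (by positivity) h'), one_pow]
  calc (δ * h ξ)⁻¹ ^ a i ≤ (q * σ ^ r) ^ a i :=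
        Real.rpow_le_rpow (by positivity) hinv (ha.pos i).le
    _ ≤ (q * σ ^ r) ^ (d : ℝ) := Real.rpow_le_rpow_of_exponent_le hbase (ha.le_dim i)
    _ = q ^ (d : ℝ) * σ ^ (r * d) := by
        rw [Real.mul_rpow (by linarith) (by linarith), ← Real.rpow_mul hσ0.le]
    _ ≤ q ^ (d : ℝ) * (σ ^ α) ^ κ := by
        rw [← Real.rpow_natCast (σ ^ α), ← Real.rpow_mul hσ0.le]
        have : r * d ≤ α * κ := by
          rw [div_le_iff₀ hα] at hκ
          linarith
        have := Real.rpow_le_rpow_of_exponent_le hσ1 this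
        have : 0 ≤ q ^ (d : ℝ) := by positivity
        gcongr
    _ ≤ q ^ (d : ℝ) * (2 * max 1 ‖ζ‖⁻¹) ^ κ := by
        have : 0 ≤ σ ^ α := Real.rpow_nonneg hσ0.le α
        gcongr
    _ = _ := by rw [mul_pow, hblow]; ring

end Anisotropic

/-! ### The square root of the partition of unity -/

section BAPU

variable {d : ℕ}

theorem mem_affImage_iff {A : Matrix (Fin d) (Fin d) ℝ} (hA : IsUnit A.det) {b ζ : E d}
    {S : Set (E d)} : ζ ∈ affImage A b S ↔ act A⁻¹ (ζ - b) ∈ S := by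
  constructor
  · rintro ⟨η, hη, rfl⟩
    rwa [add_sub_cancel_right, act_act, Matrix.nonsing_inv_mul A hA, act_one]
  · intro h
    refine ⟨_, h, ?_⟩
    change act A (act A⁻¹ (ζ - b)) + b = ζ
    rw [act_act, Matrix.mul_nonsing_inv A hA, act_one, sub_add_cancel]

theorem contDiff_act_sub (M : Matrix (Fin d) (Fin d) ℝ) (b : E d) :
    ContDiff ℝ ∞ fun ζ : E d => act M (ζ - b) :=
  (Matrix.toLpLin 2 2 M).toContinuousLinearMap.contDiff.comp (contDiff_id.sub contDiff_const)

theorem isOpen_affImage {A : Matrix (Fin d) (Fin d) ℝ} (hA : IsUnit A.det) (b : E d)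
    {S : Set (E d)} (hS : IsOpen S) : IsOpen (affImage A b S) := by
  have : affImage A b S = (fun ζ => act A⁻¹ (ζ - b)) ⁻¹' S := by
    ext ζ
    exact mem_affImage_iff hA
  rw [this]
  exact hS.preimage (contDiff_act_sub _ _).continuous

theorem contDiff_bump {Φ : E d → ℝ} (hΦ : ContDiff ℝ ∞ Φ) (A : Matrix (Fin d) (Fin d) ℝ)
    (b : E d) : ContDiff ℝ ∞ (bump Φ A b) :=
  hΦ.comp (contDiff_act_sub _ _)

theorem tsupport_bump_subset {Φ : E d → ℝ} {A : Matrix (Fin d) (Fin d) ℝ} (hA : IsUnit A.det)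
    (b : E d) : tsupport (bump Φ A b) ⊆ affImage A b (tsupport Φ) := by
  refine closure_minimal (fun ζ hζ => (mem_affImage_iff hA).mpr (subset_tsupport _ hζ)) ?_
  have : affImage A b (tsupport Φ) = (fun ζ => act A⁻¹ (ζ - b)) ⁻¹' tsupport Φ := by
    ext ζ
    exact mem_affImage_iff hA
  rw [this]
  exact (isClosed_tsupport Φ).preimage (contDiff_act_sub _ _).continuous

theorem hasCompactSupport_bump {Φ : E d → ℝ} (hΦ : HasCompactSupport Φ)
    {A : Matrix (Fin d) (Fin d) ℝ} (hA : IsUnit A.det) (b : E d) :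
    HasCompactSupport (bump Φ A b) := by
  refine HasCompactSupport.of_support_subset_isCompact (K := affImage A b (tsupport Φ)) ?_
    ((subset_tsupport _).trans (tsupport_bump_subset hA b))
  exact hΦ.isCompact.image ((Matrix.toLpLin 2 2 A).toContinuousLinearMap.continuous.add
    continuous_const)

theorem norm_iteratedFDeriv_comp_act_sub_le {G : E d → ℝ} (hG : ContDiff ℝ ∞ G)
    (M : Matrix (Fin d) (Fin d) ℝ) (b ζ : E d) {K : ℝ} (hK : 0 ≤ K)
    (hM : ∀ η, ‖act M η‖ ≤ K * ‖η‖) (i : ℕ) :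
    ‖iteratedFDeriv ℝ i (fun ζ => G (act M (ζ - b))) ζ‖ ≤
      ‖iteratedFDeriv ℝ i G (act M (ζ - b))‖ * K ^ i := by
  set L : E d →L[ℝ] E d := (Matrix.toLpLin 2 2 M).toContinuousLinearMap with hL
  have hLn : ‖L‖ ≤ K := L.opNorm_le_bound hK hM
  change ‖iteratedFDeriv ℝ i (fun ζ => G (L (ζ - b))) ζ‖ ≤ _
  rw [iteratedFDeriv_comp_sub (𝕜 := ℝ) (f := fun ζ => G (L ζ)) i b]
  have h := L.iteratedFDeriv_comp_right (n := ∞) hG (ζ - b) (i := i) (mod_cast le_top)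
  change ‖iteratedFDeriv ℝ i (G ∘ L) (ζ - b)‖ ≤ _
  rw [h]
  refine (ContinuousMultilinearMap.norm_compContinuousLinearMap_le _ _).trans ?_
  rw [Finset.prod_const, Finset.card_univ, Fintype.card_fin]
  gcongr
  exact le_rfl

theorem exists_bound_iteratedFDeriv_of_hasCompactSupport {G : E d → ℝ} (hG : ContDiff ℝ ∞ G)
    (hc : HasCompactSupport G) (i : ℕ) : ∃ B : ℝ, ∀ ζ, ‖iteratedFDeriv ℝ i G ζ‖ ≤ B :=
  (hc.iteratedFDeriv i).exists_bound_of_continuous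
    (hG.continuous_iteratedFDeriv (mod_cast le_top))

theorem IsGenerator.hasCompactSupport {J : Type*} {A : J → Matrix (Fin d) (Fin d) ℝ} {b : J → E d}
    {P Q : Set (E d)} {Φ : E d → ℝ} (hc : IsStructuredCovering A b P Q)
    (hΦ : IsGenerator P Q Φ) : HasCompactSupport Φ :=
  Metric.isCompact_of_isClosed_isBounded (isClosed_tsupport Φ) (hc.bounded.subset hΦ.support)

theorem IsStructuredCovering.zero_notMem_affImage {J : Type*} {A : J → Matrix (Fin d) (Fin d) ℝ}
    {b : J → E d} {P Q : Set (E d)} (hc : IsStructuredCovering A b P Q) (j : J) :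
    (0 : E d) ∉ affImage (A j) (b j) Q := fun h => by
  have h' : (0 : E d) ∈ ⋃ j, affImage (A j) (b j) Q := Set.mem_iUnion.mpr ⟨j, h⟩
  rw [hc.admissible_outer.cover] at h'
  exact h' rfl

/-- The functions `g_j²` form a tame family if the matrices `A_j⁻¹` satisfy the corresponding
bound on the sets `T_j Q`. -/
theorem IsGenerator.isTameFamily_bump_sq {J : Type*} {A : J → Matrix (Fin d) (Fin d) ℝ}
    {b : J → E d} {P Q : Set (E d)} {Φ : E d → ℝ} (hc : IsStructuredCovering A b P Q)
    (hΦ : IsGenerator P Q Φ) {κ : ℕ} {K : ℝ} (hK : 0 ≤ K)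
    (hA : ∀ j, ∀ ζ ∈ affImage (A j) (b j) Q, ζ ≠ 0 →
      ∀ η, ‖act (A j)⁻¹ η‖ ≤ K * blowup κ ζ * ‖η‖) :
    IsTameFamily κ (fun j => affImage (A j) (b j) Q) fun j ζ => bump Φ (A j) (b j) ζ ^ 2 := by
  have hsub : ∀ j, tsupport (fun ζ => bump Φ (A j) (b j) ζ ^ 2) ⊆ affImage (A j) (b j) Q := by
    intro j
    have h1 : (fun ζ => bump Φ (A j) (b j) ζ ^ 2) =
        fun ζ => bump Φ (A j) (b j) ζ * bump Φ (A j) (b j) ζ := by funext ζ; ring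
    rw [h1]
    exact tsupport_mul_subset_left.trans ((tsupport_bump_subset (hc.invertible j) _).trans
      (Set.image_mono hΦ.support))
  refine ⟨fun j => (contDiff_bump hΦ.smooth _ _).pow 2, hsub, ?_, fun i => ?_⟩
  · obtain ⟨N, hN⟩ := hc.admissible_outer.finite_overlap
    refine ⟨N, fun ξ hξ => ?_⟩
    have hmem : ξ ∈ ⋃ j, affImage (A j) (b j) Q := by
      rw [hc.admissible_outer.cover]
      exact hξ
    obtain ⟨j, hj⟩ := Set.mem_iUnion.mp hmem
    exact ⟨_, (isOpen_affImage (hc.invertible j) _ hc.isOpen_outer).mem_nhds hj, hN j⟩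
  · have hG : ContDiff ℝ ∞ fun ζ => Φ ζ ^ 2 := hΦ.smooth.pow 2
    have hGc : HasCompactSupport fun ζ => Φ ζ ^ 2 :=
      (hΦ.hasCompactSupport hc).comp_left (g := fun y : ℝ => y ^ 2) (by norm_num)
    obtain ⟨B, hB⟩ := exists_bound_iteratedFDeriv_of_hasCompactSupport hG hGc i
    have hB0 : 0 ≤ B := (norm_nonneg _).trans (hB 0)
    refine ⟨B * K ^ i, fun j ζ hζ => ?_⟩
    have hb := blowup_pos κ ζ
    by_cases hmem : ζ ∈ affImage (A j) (b j) Q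
    · refine (norm_iteratedFDeriv_comp_act_sub_le hG (A j)⁻¹ (b j) ζ (by positivity)
        (hA j ζ hmem hζ) i).trans ?_
      rw [mul_pow, mul_assoc]
      gcongr
      exact hB _
    · rw [iteratedFDeriv_eq_zero_of_notMem_tsupport (fun h => hmem (hsub j h)), norm_zero]
      positivity

theorem IsGenerator.one_le_partialSum {J : Type*} {A : J → Matrix (Fin d) (Fin d) ℝ}
    {b : J → E d} {P Q : Set (E d)} {Φ : E d → ℝ} (hc : IsStructuredCovering A b P Q)
    (hΦ : IsGenerator P Q Φ) {κ : ℕ}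
    (hg : IsTameFamily κ (fun j => affImage (A j) (b j) Q) fun j ζ => bump Φ (A j) (b j) ζ ^ 2)
    {ξ : E d} (hξ : ξ ≠ 0) :
    1 ≤ partialSum (fun j ζ => bump Φ (A j) (b j) ζ ^ 2) Set.univ ξ := by
  have hmem : ξ ∈ ⋃ j, affImage (A j) (b j) P := by
    rw [hc.admissible_inner.cover]
    exact hξ
  obtain ⟨j, hj⟩ := Set.mem_iUnion.mp hmem
  have h1 : bump Φ (A j) (b j) ξ ^ 2 = 1 := by
    rw [bump, hΦ.eq_one _ ((mem_affImage_iff (hc.invertible j)).mp hj), one_pow]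
  obtain ⟨N, hN⟩ := hg.exists_finset
  obtain ⟨s, -, hs⟩ := hN ξ hξ
  have hsum : Summable fun k => bump Φ (A k) (b k) ξ ^ 2 :=
    summable_of_ne_finset_zero (s := s) fun k hk => hs.self_of_nhds k hk
  rw [← h1]
  rw [partialSum_univ]
  exact hsum.le_tsum j fun k _ => sq_nonneg _

/-- The functions `φ_j` are Schwartz functions, and their squares form a tame partition of unity of
`ℝ^d \ {0}`. -/
theorem IsGenerator.exists_schwartz_sqrtBAPU {J : Type*} {A : J → Matrix (Fin d) (Fin d) ℝ}
    {b : J → E d} {P Q : Set (E d)} {Φ : E d → ℝ} (hc : IsStructuredCovering A b P Q)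
    (hΦ : IsGenerator P Q Φ) {κ : ℕ} {K : ℝ} (hK : 0 ≤ K)
    (hA : ∀ j, ∀ ζ ∈ affImage (A j) (b j) Q, ζ ≠ 0 →
      ∀ η, ‖act (A j)⁻¹ η‖ ≤ K * blowup κ ζ * ‖η‖) :
    ∃ φ : J → 𝓢(E d, ℂ), (∀ j η, φ j η = (sqrtBAPU Φ A b j η : ℂ)) ∧
      IsTameFamily κ (fun j => affImage (A j) (b j) Q) (fun j => ⇑(square (φ j))) ∧
      ∀ ξ : E d, ξ ≠ 0 → partialSum (fun j => ⇑(square (φ j))) Set.univ ξ = 1 := by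
  have hg := hΦ.isTameFamily_bump_sq hc hK hA
  set g : J → E d → ℝ := fun j ζ => bump Φ (A j) (b j) ζ ^ 2
  have h1 : ∀ ξ : E d, ξ ≠ 0 → 1 ≤ partialSum g Set.univ ξ :=
    fun ξ hξ => hΦ.one_le_partialSum hc hg hξ
  have hS0 : ∀ ξ, 0 ≤ partialSum g Set.univ ξ := fun ξ => by
    rw [partialSum_univ]
    exact tsum_nonneg fun k => sq_nonneg _
  have hsqrt : ∀ j ξ, sqrtBAPU Φ A b j ξ = bump Φ (A j) (b j) ξ / √(partialSum g Set.univ ξ) :=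
    fun j ξ => by rw [partialSum_univ]; rfl
  have hnear : ∀ j, bump Φ (A j) (b j) =ᶠ[𝓝 0] 0 := fun j => by
    refine notMem_tsupport_iff_eventuallyEq.mp fun h => hc.zero_notMem_affImage j ?_
    exact Set.image_mono hΦ.support (tsupport_bump_subset (hc.invertible j) _ h)
  have hsmooth : ∀ j, ContDiff ℝ ∞ (sqrtBAPU Φ A b j) := fun j => by
    refine contDiff_iff_contDiffAt.mpr fun ξ => ?_
    by_cases hξ : ξ = 0
    · subst hξ
      refine (contDiffAt_const (c := (0 : ℝ))).congr_of_eventuallyEq ?_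
      filter_upwards [hnear j] with ζ hζ
      rw [hsqrt, hζ, Pi.zero_apply, zero_div]
    · have hSpos : 0 < partialSum g Set.univ ξ := zero_lt_one.trans_le (h1 ξ hξ)
      have hSd : ContDiffAt ℝ ∞ (partialSum g Set.univ) ξ :=
        (hg.contDiffOn_partialSum Set.univ).contDiffAt (isOpen_compl_singleton.mem_nhds hξ)
      have := (contDiff_bump hΦ.smooth (A j) (b j)).contDiffAt.div (hSd.sqrt hSpos.ne')
        (Real.sqrt_pos.mpr hSpos).ne' (x := ξ)
      exact this.congr_of_eventuallyEq (Eventually.of_forall fun ζ => hsqrt j ζ)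
  have hcs : ∀ j, HasCompactSupport (sqrtBAPU Φ A b j) := fun j =>
    (hasCompactSupport_bump (hΦ.hasCompactSupport hc) (hc.invertible j) (b j)).mono fun ζ hζ h => by
      refine hζ ?_
      rw [hsqrt, h, zero_div]
  let φ : J → 𝓢(E d, ℂ) := fun j =>
    HasCompactSupport.toSchwartzMap (f := fun ζ => (sqrtBAPU Φ A b j ζ : ℂ))
      ((hcs j).comp_left Complex.ofReal_zero) (Complex.ofRealCLM.contDiff.comp (hsmooth j))
  have hφ : ∀ j η, φ j η = (sqrtBAPU Φ A b j η : ℂ) := fun j η => rfl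
  have hsq : ∀ j, ⇑(square (φ j)) =
      ⇑Complex.ofRealLI ∘ fun ξ => g j ξ / partialSum g Set.univ ξ := fun j => by
    funext ξ
    have h2 : square (φ j) ξ = φ j ξ * φ j ξ := rfl
    rw [h2, hφ, hsqrt, Function.comp_apply, Complex.ofRealLI_apply, ← Complex.ofReal_mul,
      div_mul_div_comm, Real.mul_self_sqrt (hS0 ξ), ← pow_two]
  have htame := hg.div_partialSum hc.zero_notMem_affImage h1
  refine ⟨φ, hφ, ⟨fun j => (square (φ j)).smooth ⊤, fun j => ?_, htame.overlap, fun i => ?_⟩,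
    fun ξ hξ => ?_⟩
  · rw [hsq]
    exact (closure_mono (Function.support_comp_subset (map_zero _) _)).trans
      (htame.tsupport_subset j)
  · obtain ⟨B, hB⟩ := htame.bound i
    refine ⟨B, fun j ξ hξ => ?_⟩
    rw [hsq, LinearIsometry.norm_iteratedFDeriv_comp_left _ (htame.smooth j).contDiffAt
      (mod_cast le_top)]
    exact hB j ξ hξ
  · have hSpos : 0 < partialSum g Set.univ ξ := zero_lt_one.trans_le (h1 ξ hξ)
    have e : partialSum (fun j => ⇑(square (φ j))) Set.univ ξ =
        ((∑' j, g j ξ / partialSum g Set.univ ξ : ℝ) : ℂ) := by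
      rw [partialSum_univ, Complex.ofReal_tsum]
      exact tsum_congr fun j => by rw [hsq]; rfl
    rw [e, tsum_div_const, ← partialSum_univ, div_self hSpos.ne', Complex.ofReal_one]

end BAPU

/-! ### Convolution on the frequency side -/

section Frequency

variable {d : ℕ}

/-- The inverse Fourier transform of `ψ` as a function of the frequency `ξ` that is paired with
`x` as `e^{i x·ξ}`: `freq ψ ξ = ∫ ψ(x) e^{i x·ξ} dx`. -/
noncomputable def freq (d : ℕ) : 𝓢(E d, ℂ) →L[ℂ] 𝓢(E d, ℂ) :=
  (SchwartzMap.compCLMOfContinuousLinearEquiv ℂ (scale d).symm) ∘L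
    FourierTransform.fourierInvCLM ℂ 𝓢(E d, ℂ)

/-- The Fourier transform of `f` as a functional of the frequency that is paired with `x` as
`e^{i x·ξ}`, normalized by `⟨f, ψ⟩ = ⟨freqDual f, freq ψ⟩`. -/
noncomputable def freqDual (f : 𝓢'(E d, ℂ)) : 𝓢(E d, ℂ) →ₗ[ℂ] ℂ :=
  (𝓕 f).toLinearMap ∘ₗ
    (SchwartzMap.compCLMOfContinuousLinearEquiv ℂ (scale d)).toLinearMap

theorem freq_apply (ψ : 𝓢(E d, ℂ)) (ξ : E d) : freq d ψ ξ = 𝓕⁻ ψ ((scale d).symm ξ) := rfl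

theorem freqDual_apply (f : 𝓢'(E d, ℂ)) (η : 𝓢(E d, ℂ)) :
    freqDual f η = (𝓕 f) (SchwartzMap.compCLMOfContinuousLinearEquiv ℂ (scale d) η) := rfl

theorem freqDual_freq (f : 𝓢'(E d, ℂ)) (ψ : 𝓢(E d, ℂ)) : freqDual f (freq d ψ) = f ψ := by
  have h : SchwartzMap.compCLMOfContinuousLinearEquiv ℂ (scale d) (freq d ψ) = 𝓕⁻ ψ := by
    ext ξ
    simp [freq_apply]
  rw [freqDual_apply, h, TemperedDistribution.fourier_apply,
    FourierTransform.fourier_fourierInv_eq]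

/-- The double Fourier transform is the reflection. -/
theorem fourier_fourier_apply (g : 𝓢(E d, ℂ)) (x : E d) : 𝓕 (𝓕 g) x = g (-x) := by
  have h : 𝓕⁻ (𝓕 g) = g := FourierTransform.fourierInv_fourier_eq g
  conv_rhs => rw [← h]
  rw [SchwartzMap.fourierInv_coe, Real.fourierInv_eq_fourier_neg, neg_neg,
    SchwartzMap.fourier_coe (𝓕 g)]

theorem fourier_reflect_kernel_apply (θ : 𝓢(E d, ℂ)) (x : E d) :
    𝓕 (reflect (kernel θ)) x = θ (scale d (-x)) := by
  have h1 : ⇑(reflect (kernel θ)) = fun y => kernel θ (-y) := rfl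
  rw [SchwartzMap.fourier_coe, h1, ← Real.fourierInv_eq_fourier_comp_neg,
    Real.fourierInv_eq_fourier_neg, ← SchwartzMap.fourier_coe, kernel,
    FourierTransform.fourier_fourierInv_eq]
  rfl

/-- Convolution with `θ̌` is multiplication by `θ` on the frequency side. -/
theorem conv_kernel_apply (θ : 𝓢(E d, ℂ)) (f : 𝓢'(E d, ℂ)) (ψ : 𝓢(E d, ℂ)) :
    conv (kernel θ) f ψ = freqDual f (SchwartzMap.smulLeftCLM ℂ θ (freq d ψ)) := by
  rw [conv_apply, freqDual_apply, TemperedDistribution.fourier_apply]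
  congr 1
  apply (FourierTransform.fourierEquiv ℂ 𝓢(E d, ℂ)).injective
  change 𝓕 (_ : 𝓢(E d, ℂ)) = 𝓕 (𝓕 (_ : 𝓢(E d, ℂ)))
  ext x
  rw [SchwartzMap.fourier_convolution, fourier_fourier_apply, SchwartzMap.pairing_apply_apply,
    fourier_reflect_kernel_apply, SchwartzMap.compCLMOfContinuousLinearEquiv_apply,
    Function.comp_apply, SchwartzMap.smulLeftCLM_apply_apply θ.hasTemperateGrowth, freq_apply,
    ContinuousLinearEquiv.symm_apply_apply, SchwartzMap.fourierInv_coe,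
    Real.fourierInv_eq_fourier_neg, neg_neg]
  rfl

theorem norm_le_norm_scale (x : E d) : ‖x‖ ≤ ‖scale d x‖ := by
  have h : scale d x = (2 * Real.pi) • x := rfl
  rw [h, norm_smul, Real.norm_of_nonneg (by positivity)]
  have := Real.pi_gt_three
  exact le_mul_of_one_le_left (norm_nonneg x) (by linarith)

/-- If the Fourier transform of `f` has order at most `m`, then so has `freqDual f`. -/
theorem FourierOrderLE.freqDual_bound {m : ℕ} {f : 𝓢'(E d, ℂ)} (hf : FourierOrderLE m f) :
    ∃ (b : ℕ) (C : ℝ), ∀ ψ : 𝓢(E d, ℂ),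
      ‖freqDual f ψ‖ ≤ C * ((Finset.Iic (b, m)).sup (schwartzSeminormFamily ℂ (E d) ℂ)) ψ := by
  obtain ⟨b, C, hC⟩ := hf
  set L : E d →L[ℝ] E d := (scale d : E d →L[ℝ] E d)
  refine ⟨b, |C| * (1 + ‖L‖) ^ m, fun ψ => ?_⟩
  set S := ((Finset.Iic (b, m)).sup (schwartzSeminormFamily ℂ (E d) ℂ)) ψ with hS
  have hS0 : 0 ≤ S := apply_nonneg _ _
  rw [freqDual_apply, mul_assoc]
  refine (hC _).trans (mul_le_mul (le_abs_self C) ?_ (apply_nonneg _ _) (abs_nonneg C))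
  refine Seminorm.finset_sup_apply_le (by positivity) fun q hq => ?_
  have hq2 : q.2 ≤ m := (Prod.mk_le_mk.mp (Finset.mem_Iic.mp hq)).2
  refine SchwartzMap.seminorm_le_bound ℂ q.1 q.2 _ (by positivity) fun x => ?_
  have h1 : ⇑(SchwartzMap.compCLMOfContinuousLinearEquiv ℂ (scale d) ψ) = ψ ∘ L := rfl
  rw [h1, L.iteratedFDeriv_comp_right (ψ.smooth ⊤) x (mod_cast le_top)]
  have h2 : ‖(iteratedFDeriv ℝ q.2 ψ (L x)).compContinuousLinearMap fun _ => L‖ ≤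
      ‖iteratedFDeriv ℝ q.2 ψ (L x)‖ * ‖L‖ ^ q.2 := by
    refine (ContinuousMultilinearMap.norm_compContinuousLinearMap_le _ _).trans_eq ?_
    rw [Finset.prod_const, Finset.card_univ, Fintype.card_fin]
  have h3 : ‖L x‖ ^ q.1 * ‖iteratedFDeriv ℝ q.2 ψ (L x)‖ ≤ S :=
    (SchwartzMap.le_seminorm ℂ q.1 q.2 ψ (L x)).trans
      ((Seminorm.le_def.mp (Finset.le_sup (f := schwartzSeminormFamily ℂ (E d) ℂ) hq)) ψ)
  have h4 : ‖L‖ ^ q.2 ≤ (1 + ‖L‖) ^ m :=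
    (pow_le_pow_left₀ (norm_nonneg _) (by linarith) _).trans
      (pow_le_pow_right₀ (by linarith [norm_nonneg L]) hq2)
  calc ‖x‖ ^ q.1 * _ ≤ ‖L x‖ ^ q.1 * (‖iteratedFDeriv ℝ q.2 ψ (L x)‖ * ‖L‖ ^ q.2) := by
        gcongr
        exact norm_le_norm_scale x
    _ = ‖L‖ ^ q.2 * (‖L x‖ ^ q.1 * ‖iteratedFDeriv ℝ q.2 ψ (L x)‖) := by ring
    _ ≤ (1 + ‖L‖) ^ m * S := by gcongr

end Frequency

/-! ### Functions with vanishing moments -/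

section Moments

variable {d : ℕ}

/-- A smooth function whose derivatives of order at most `M` vanish at the origin and whose
derivatives of order `M + 1` are bounded satisfies Taylor bounds. -/
theorem exists_bound_of_iteratedFDeriv_eq_zero {V : Type*} [NormedAddCommGroup V]
    [NormedSpace ℝ V] (η : 𝓢(V, ℂ)) {M : ℕ} (h : ∀ k ≤ M, iteratedFDeriv ℝ k η 0 = 0) :
    ∃ K : ℝ, ∀ i ≤ M + 1, ∀ ξ : V, ‖iteratedFDeriv ℝ i η ξ‖ ≤ K * ‖ξ‖ ^ (M + 1 - i) := by
  refine ⟨SchwartzMap.seminorm ℝ 0 (M + 1) η, fun i hi => ?_⟩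
  have hK : 0 ≤ SchwartzMap.seminorm ℝ 0 (M + 1) η := apply_nonneg _ _
  obtain ⟨t, ht⟩ : ∃ t, i + t = M + 1 := ⟨M + 1 - i, by omega⟩
  have e : M + 1 - i = t := by omega
  rw [e]
  clear hi e
  induction t generalizing i with
  | zero =>
    intro ξ
    rw [add_zero] at ht
    rw [ht, pow_zero, mul_one]
    exact η.norm_iteratedFDeriv_le_seminorm ℝ (M + 1) ξ
  | succ t ih =>
    intro ξ
    have hd : ∀ y, DifferentiableAt ℝ (iteratedFDeriv ℝ i η) y := fun y =>
      (η.smooth ⊤).differentiable_iteratedFDeriv (m := i)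
        (by exact_mod_cast WithTop.coe_lt_top _) y
    have hmv := (convex_closedBall (0 : V) ‖ξ‖).norm_image_sub_le_of_norm_fderiv_le
      (𝕜 := ℝ) (f := iteratedFDeriv ℝ i η)
      (C := SchwartzMap.seminorm ℝ 0 (M + 1) η * ‖ξ‖ ^ t) (fun y _ => hd y) (fun y hy => ?_)
      (Metric.mem_closedBall_self (norm_nonneg ξ)) (y := ξ) (by simp)
    · rw [h i (by omega), sub_zero, sub_zero] at hmv
      rwa [pow_succ, ← mul_assoc]
    · rw [norm_fderiv_iteratedFDeriv]
      refine (ih (i + 1) (by omega) y).trans ?_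
      gcongr
      simpa using hy

/-- The monomial `x_{e 0} ⋯ x_{e (k - 1)}`. -/
noncomputable def monom {k : ℕ} (e : Fin k → Fin d) : MvPolynomial (Fin d) ℂ :=
  ∏ i, MvPolynomial.X (e i)

theorem totalDegree_monom_le {k : ℕ} (e : Fin k → Fin d) : (monom e).totalDegree ≤ k := by
  refine (MvPolynomial.totalDegree_finsetProd _ _).trans ?_
  simp [MvPolynomial.totalDegree_X]

theorem polyDist_monom_apply {k : ℕ} (e : Fin k → Fin d) (ψ : 𝓢(E d, ℂ)) :
    polyDist (monom e) ψ = ∫ x : E d, ψ x * ∏ i, ((x (e i) : ℝ) : ℂ) := by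
  rw [polyDist_apply]
  simp [polyFun, monom, map_prod]

/-- If the moments of order `k` of `ψ` vanish, then the derivatives of order `k` of its Fourier
transform vanish at the origin. -/
theorem iteratedFDeriv_fourier_zero_eq_zero {k : ℕ} {ψ : 𝓢(E d, ℂ)}
    (h : ∀ e : Fin k → Fin d, polyDist (monom e) ψ = 0) :
    iteratedFDeriv ℝ k ⇑(𝓕 ψ : 𝓢(E d, ℂ)) 0 = 0 := by
  have hint : ∀ n : ℕ, Integrable fun v : E d => ‖v‖ ^ n * ‖ψ v‖ := fun n =>
    ψ.integrable_pow_mul volume n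
  have hmeas : AEStronglyMeasurable ψ (volume : Measure (E d)) :=
    ψ.continuous.aestronglyMeasurable
  have hI : Integrable fun v : E d => VectorFourier.fourierPowSMulRight (innerSL ℝ) ψ v k :=
    VectorFourier.integrable_fourierPowSMulRight (innerSL ℝ) (hint k) hmeas
  rw [SchwartzMap.fourier_coe,
    Real.iteratedFDeriv_fourier (N := ⊤) (fun n _ => hint n) hmeas le_top, Real.fourier_eq]
  simp only [inner_zero_right, neg_zero, AddChar.map_zero_eq_one, one_smul]
  apply ContinuousMultilinearMap.toMultilinearMap_injective
  refine Module.Basis.ext_multilinear (fun _ => (EuclideanSpace.basisFun (Fin d) ℝ).toBasis)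
    fun e => ?_
  simp only [ContinuousMultilinearMap.coe_coe]
  rw [ContinuousMultilinearMap.integral_apply hI]
  simp only [VectorFourier.fourierPowSMulRight_apply]
  rw [integral_smul]
  have h' := h e
  rw [polyDist_monom_apply] at h'
  have : ∫ v : E d, (∏ i, (innerSL ℝ v) ((EuclideanSpace.basisFun (Fin d) ℝ).toBasis (e i))) • ψ v
      = 0 := by
    rw [← h']
    refine integral_congr_ae (Eventually.of_forall fun v => ?_)
    simp [EuclideanSpace.inner_single_right, mul_comm]
  rw [this, smul_zero]
  rfl

theorem iteratedFDeriv_freq_zero_eq_zero {k : ℕ} {ψ : 𝓢(E d, ℂ)}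
    (h : ∀ e : Fin k → Fin d, polyDist (monom e) ψ = 0) :
    iteratedFDeriv ℝ k (freq d ψ) 0 = 0 := by
  set L : E d →L[ℝ] E d := -((scale d).symm : E d →L[ℝ] E d) with hL
  have h1 : ⇑(freq d ψ) = ⇑(𝓕 ψ : 𝓢(E d, ℂ)) ∘ L := by
    funext ξ
    rw [freq_apply, SchwartzMap.fourierInv_coe, Real.fourierInv_eq_fourier_neg]
    rfl
  rw [h1, L.iteratedFDeriv_comp_right ((𝓕 ψ : 𝓢(E d, ℂ)).smooth ⊤) 0 (mod_cast le_top), map_zero,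
    iteratedFDeriv_fourier_zero_eq_zero h]
  rfl

/-- A finite family of linear functionals `L i` admits vectors `τ i` such that subtracting
`∑ L i v • τ i` from `v` makes all functionals vanish. -/
theorem exists_correction {ι K V : Type*} [Fintype ι] [Field K] [AddCommGroup V] [Module K V]
    (L : ι → V →ₗ[K] K) :
    ∃ τ : ι → V, ∀ v i, L i (v - ∑ k, L k v • τ k) = 0 := by
  classical
  -- `s` is a section of `Λ` over its range; `s'` extends it to all of `ι → K`.
  let Λ : V →ₗ[K] (ι → K) := LinearMap.pi L
  obtain ⟨s, hs⟩ := Λ.rangeRestrict.exists_rightInverse_of_surjective Λ.range_rangeRestrict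
  obtain ⟨s', hs'⟩ := s.exists_extend
  refine ⟨fun k => s' (Pi.single k 1), fun v i => ?_⟩
  have h1 : ∑ k, L k v • s' (Pi.single k 1) = s' (Λ v) := by
    conv_rhs => rw [pi_eq_sum_univ' (Λ v)]
    rw [map_sum]
    exact Finset.sum_congr rfl fun k _ => (map_smul s' _ _).symm
  have h2 : s' (Λ v) = s (Λ.rangeRestrict v) := by
    rw [← hs']
    rfl
  have h3 : Λ (s (Λ.rangeRestrict v)) = Λ v := by
    have := congrArg Subtype.val (LinearMap.congr_fun hs (Λ.rangeRestrict v))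
    exact this
  rw [map_sub, h1, h2]
  exact sub_eq_zero.mpr (congrFun h3 i).symm

/-- The index set of the monomials of degree at most `M`. -/
abbrev MonomIndex (d M : ℕ) : Type := Σ k : Fin (M + 1), (Fin k → Fin d)

/-- Each tempered distribution `v` agrees with a polynomial of degree at most `M`, up to its values
at test functions with vanishing moments of order at most `M`. The test functions `τ` do not depend
on `v`. -/
theorem exists_moment_correction (d M : ℕ) : ∃ τ : MonomIndex d M → 𝓢(E d, ℂ),
    (∀ ψ, ∀ k ≤ M, iteratedFDeriv ℝ k
      (freq d (ψ - ∑ e, polyDist (monom e.2) ψ • τ e)) 0 = 0) ∧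
    ∀ (v : 𝓢'(E d, ℂ)) (ψ : 𝓢(E d, ℂ)),
      v ψ = v (ψ - ∑ e, polyDist (monom e.2) ψ • τ e) +
        polyDist (∑ e, v (τ e) • monom e.2) ψ := by
  obtain ⟨τ, hτ⟩ := exists_correction fun e : MonomIndex d M =>
    (polyDist (monom e.2)).toLinearMap
  refine ⟨τ, fun ψ k hk => iteratedFDeriv_freq_zero_eq_zero fun e => ?_, fun v ψ => ?_⟩
  · exact hτ ψ ⟨⟨k, by omega⟩, e⟩
  · rw [map_sub, map_sum, map_sum]
    have h1 : (∑ e, polyDist (v (τ e) • monom e.2)) ψ =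
        ∑ e : MonomIndex d M, v (τ e) * polyDist (monom e.2) ψ := by
      simp
    rw [h1]
    simp [mul_comm]

theorem totalDegree_sum_monom_le {M : ℕ} (c : MonomIndex d M → ℂ) :
    (∑ e, c e • monom e.2).totalDegree ≤ M := by
  refine MvPolynomial.totalDegree_finsetSum_le fun e _ => ?_
  exact (MvPolynomial.totalDegree_smul_le _ _).trans
    ((totalDegree_monom_le e.2).trans (Nat.lt_succ_iff.mp e.1.2))

end Moments

/-! ### Convergence modulo polynomials -/

section Decomposition

variable {d : ℕ} {J : Type*}

theorem IsTameFamily.partialSum_add_partialSum_compl {V F : Type*} [NormedAddCommGroup V]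
    [NormedSpace ℝ V] [NormedAddCommGroup F] [NormedSpace ℝ F] {κ : ℕ} {U : J → Set V}
    {θ : J → V → F} (hθ : IsTameFamily κ U θ) (I : Set J) {ξ : V} (hξ : ξ ≠ 0) :
    partialSum θ I ξ + partialSum θ Iᶜ ξ = partialSum θ Set.univ ξ := by
  classical
  obtain ⟨N, hN⟩ := hθ.exists_finset
  obtain ⟨s, -, hs⟩ := hN ξ hξ
  rw [partialSum_eq_sum hs.self_of_nhds, partialSum_eq_sum hs.self_of_nhds,
    partialSum_eq_sum hs.self_of_nhds]
  simp only [Set.mem_compl_iff, Set.mem_univ, Finset.filter_true]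
  exact Finset.sum_filter_add_sum_filter_not s (· ∈ I) _

/-- The tempered distribution with Fourier transform `W f̂`. -/
noncomputable def fourierMul (W : E d → ℂ) (f : 𝓢'(E d, ℂ)) : 𝓢'(E d, ℂ) :=
  PointwiseConvergenceCLM.precomp ℂ
    ((SchwartzMap.compCLMOfContinuousLinearEquiv ℂ (scale d)) ∘L
      (SchwartzMap.smulLeftCLM ℂ W) ∘L freq d) (𝓕 f)

theorem fourierMul_apply (W : E d → ℂ) (f : 𝓢'(E d, ℂ)) (ψ : 𝓢(E d, ℂ)) :
    fourierMul W f ψ = freqDual f (SchwartzMap.smulLeftCLM ℂ W (freq d ψ)) := rfl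

theorem sub_fourierMul_apply {W : E d → ℂ} (hW : W.HasTemperateGrowth) (f : 𝓢'(E d, ℂ))
    (ψ : 𝓢(E d, ℂ)) :
    (f - fourierMul W f) ψ = freqDual f (SchwartzMap.smulLeftCLM ℂ (1 - W) (freq d ψ)) := by
  have h1 : (1 : E d → ℂ).HasTemperateGrowth := Function.HasTemperateGrowth.const 1
  have h2 : SchwartzMap.smulLeftCLM ℂ (1 : E d → ℂ) (freq d ψ) = freq d ψ := by
    ext ξ
    simp [SchwartzMap.smulLeftCLM_apply_apply h1]
  rw [SchwartzMap.smulLeftCLM_sub h1 hW, sub_apply, sub_apply, h2, map_sub, freqDual_freq]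
  rfl

theorem sum_conv_kernel_apply (θ : J → 𝓢(E d, ℂ)) (f : 𝓢'(E d, ℂ)) (s : Finset J)
    (ψ : 𝓢(E d, ℂ)) :
    (∑ j ∈ s, conv (kernel (θ j)) f) ψ =
      ∑ j ∈ s, freqDual f (SchwartzMap.smulLeftCLM ℂ (θ j) (freq d ψ)) := by
  rw [sum_apply]
  exact Finset.sum_congr rfl fun j _ => conv_kernel_apply _ _ _

theorem mkQ_polyDist (P : MvPolynomial (Fin d) ℂ) : (polys d).mkQ (polyDist P) = 0 := by
  rw [Submodule.mkQ_apply, Submodule.Quotient.mk_eq_zero]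
  exact ⟨P, rfl⟩

/-- Unconditional summability in `𝒮' / 𝒫` follows from convergence in `𝒮'` of the finite partial
sums after correction by polynomials. -/
theorem hasSum_mkQ {S : Set J} {v : J → 𝓢'(E d, ℂ)} {w : 𝓢'(E d, ℂ)}
    {R : Finset S → MvPolynomial (Fin d) ℂ}
    (h : Tendsto (fun s : Finset S =>
      ∑ j ∈ s.map (Function.Embedding.subtype _), v j + polyDist (R s)) atTop (𝓝 w)) :
    HasSum (fun j : S => (polys d).mkQ (v j)) ((polys d).mkQ w) := by
  have hcont : Continuous (polys d).mkQ := QuotientAddGroup.continuous_mk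
  have h' := (hcont.tendsto w).comp h
  refine h'.congr fun s => ?_
  simp only [Function.comp_apply, map_add, mkQ_polyDist, add_zero, map_sum, Finset.sum_map,
    Function.Embedding.subtype_apply]

variable [Nontrivial (E d)] {κ m : ℕ} {U : J → Set (E d)} {θ : J → 𝓢(E d, ℂ)}
  {α : Type*} {l : Filter α} {F : α → Finset J} {f : 𝓢'(E d, ℂ)} {c : ℝ} {I : Set J}

/-- The sum over sets that avoid a ball around the origin converges in `𝒮'`. -/
theorem IsTameFamily.tendsto_sum_conv_high (hθ : IsTameFamily κ U fun j => ⇑(θ j)) (hc : 0 < c)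
    (hI : ∀ j ∈ I, ∀ ξ ∈ U j, c ≤ ‖ξ‖) (hf : FourierOrderLE m f) (hFI : ∀ x, ↑(F x) ⊆ I)
    (hF : ∀ j ∈ I, ∀ᶠ x in l, j ∈ F x) :
    Tendsto (fun x => ∑ j ∈ F x, conv (kernel (θ j)) f) l
      (𝓝 (fourierMul (partialSum (fun j => ⇑(θ j)) I) f)) := by
  rw [PointwiseConvergenceCLM.tendsto_iff_forall_tendsto]
  intro ψ
  obtain ⟨b, C, hu⟩ := hf.freqDual_bound
  simp only [sum_conv_kernel_apply, fourierMul_apply]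
  refine hθ.tendsto_apply (hθ.hasTemperateGrowth_partialSum hc hI) (fun _ _ => rfl) (freq d ψ) ?_
    hFI hF _ hu
  refine ⟨(∑ i ∈ Finset.range (m + 1), SchwartzMap.seminorm ℝ 0 i (freq d ψ)) /
    c ^ (κ * m + 1), fun i hi j hj ξ hξ _ => ?_⟩
  have h1 : ‖iteratedFDeriv ℝ i (freq d ψ) ξ‖ ≤
      ∑ i ∈ Finset.range (m + 1), SchwartzMap.seminorm ℝ 0 i (freq d ψ) :=
    ((freq d ψ).norm_iteratedFDeriv_le_seminorm ℝ i ξ).trans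
      (Finset.single_le_sum (f := fun i => SchwartzMap.seminorm ℝ 0 i (freq d ψ))
        (fun _ _ => apply_nonneg _ _) (Finset.mem_range.mpr (by omega)))
  rw [div_mul_eq_mul_div, le_div_iff₀ (by positivity)]
  exact mul_le_mul h1 (pow_le_pow_left₀ hc.le (hI j hj ξ hξ) _) (by positivity)
    ((norm_nonneg _).trans h1)

/-- The remaining sum converges at those test functions whose Fourier transforms vanish at the
origin to order `κ m + m`. -/
theorem IsTameFamily.tendsto_sum_conv_low (hθ : IsTameFamily κ U fun j => ⇑(θ j))
    (hone : ∀ ξ : E d, ξ ≠ 0 → partialSum (fun j => ⇑(θ j)) Set.univ ξ = 1) (hc : 0 < c)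
    (hI : ∀ j ∈ I, ∀ ξ ∈ U j, c ≤ ‖ξ‖) (hf : FourierOrderLE m f) (hFI : ∀ x, ↑(F x) ⊆ Iᶜ)
    (hF : ∀ j ∈ Iᶜ, ∀ᶠ x in l, j ∈ F x) {ψ : 𝓢(E d, ℂ)}
    (hψ : ∀ k ≤ κ * m + m, iteratedFDeriv ℝ k (freq d ψ) 0 = 0) :
    Tendsto (fun x => (∑ j ∈ F x, conv (kernel (θ j)) f) ψ) l
      (𝓝 ((f - fourierMul (partialSum (fun j => ⇑(θ j)) I) f) ψ)) := by
  obtain ⟨b, C, hu⟩ := hf.freqDual_bound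
  have hW := hθ.hasTemperateGrowth_partialSum hc hI
  have h1W : (1 - partialSum (fun j => ⇑(θ j)) I : E d → ℂ).HasTemperateGrowth :=
    (Function.HasTemperateGrowth.const (1 : ℂ)).sub hW
  simp only [sum_conv_kernel_apply]
  rw [sub_fourierMul_apply hW]
  refine hθ.tendsto_apply h1W (fun ξ hξ => ?_) (freq d ψ) ?_ hFI hF _ hu
  · rw [Pi.sub_apply, Pi.one_apply, ← hone ξ hξ, ← hθ.partialSum_add_partialSum_compl I hξ,
      add_sub_cancel_left]
  · obtain ⟨K, hK⟩ := exists_bound_of_iteratedFDeriv_eq_zero (freq d ψ) hψ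
    refine ⟨|K|, fun i hi j _ ξ _ hξ => (hK i (by omega) ξ).trans ?_⟩
    exact mul_le_mul (le_abs_self K) (pow_le_pow_of_le_one (norm_nonneg ξ) hξ (by omega))
      (by positivity) (abs_nonneg K)

/-- After subtraction of polynomials of degree at most `κ m + m`, the sum over the sets near the
origin converges in `𝒮'`. -/
theorem IsTameFamily.exists_tendsto_sum_conv_low (hθ : IsTameFamily κ U fun j => ⇑(θ j))
    (hone : ∀ ξ : E d, ξ ≠ 0 → partialSum (fun j => ⇑(θ j)) Set.univ ξ = 1) (hc : 0 < c)
    (hI : ∀ j ∈ I, ∀ ξ ∈ U j, c ≤ ‖ξ‖) (hf : FourierOrderLE m f) (hFI : ∀ x, ↑(F x) ⊆ Iᶜ)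
    (hF : ∀ j ∈ Iᶜ, ∀ᶠ x in l, j ∈ F x) :
    ∃ (R : α → MvPolynomial (Fin d) ℂ) (R₀ : MvPolynomial (Fin d) ℂ),
      (∀ x, (R x).totalDegree ≤ κ * m + m) ∧
      Tendsto (fun x => ∑ j ∈ F x, conv (kernel (θ j)) f + polyDist (R x)) l
        (𝓝 (f - fourierMul (partialSum (fun j => ⇑(θ j)) I) f - polyDist R₀)) := by
  obtain ⟨τ, hτ, hv⟩ := exists_moment_correction d (κ * m + m)
  set w := f - fourierMul (partialSum (fun j => ⇑(θ j)) I) f with hw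
  refine ⟨fun x => -∑ e, (∑ j ∈ F x, conv (kernel (θ j)) f) (τ e) • monom e.2,
    ∑ e, w (τ e) • monom e.2, fun x => ?_, ?_⟩
  · rw [MvPolynomial.totalDegree_neg]
    exact totalDegree_sum_monom_le _
  · rw [PointwiseConvergenceCLM.tendsto_iff_forall_tendsto]
    intro ψ
    have key : ∀ v : 𝓢'(E d, ℂ), (v - polyDist (∑ e, v (τ e) • monom e.2)) ψ =
        v (ψ - ∑ e, polyDist (monom e.2) ψ • τ e) := fun v => by
      rw [sub_apply, hv v ψ, add_sub_cancel_right]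
    simp only [map_neg, ← sub_eq_add_neg]
    simp only [key]
    exact hθ.tendsto_sum_conv_low hone hc hI hf hFI hF (hτ ψ)

end Decomposition

end HomDecomp

theorem lemma5p1 {d : ℕ} (a : Fin d → ℝ) (ha : IsAnisotropy a) (r : ℝ) :
    ∃ p : ℕ → ℕ, ∀ (J : Type u) (h : E d → ℝ) (δ : ℝ) (ξ : J → E d)
      (A : J → Matrix (Fin d) (Fin d) ℝ) (b : J → E d) (P Q : Set (E d)) (Φ : E d → ℝ),
      IsHybridRegulation a r h → 0 < δ → (∀ j, ξ j ≠ 0) →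
      IsStructuredCovering A b P Q →
      (∀ j, A j = dilation a (δ * h (ξ j))) →
      (∀ j, affImage (A j) (b j) Q = aball a (ξ j) (δ * h (ξ j))) →
      IsGenerator P Q Φ →
      ∃ φ : J → 𝓢(E d, ℂ), (∀ j η, φ j η = (sqrtBAPU Φ A b j η : ℂ)) ∧
        ∀ (C : ℝ), 0 < C → ∀ (J₁ J₂ : Set J),
          J₂ = {j | Disjoint (aball a (ξ j) (δ * h (ξ j))) (aball a 0 C)} → J₁ = J₂ᶜ →
          ∀ f : 𝓢'(E d, ℂ),
            -- convergence of both series in the quotient `𝒮' / 𝒫`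
            (∃ u₁ u₂ : 𝓢'(E d, ℂ) ⧸ polys d,
              HasSum (fun j : J₁ => (polys d).mkQ (conv (kernel (square (φ j))) f)) u₁ ∧
              HasSum (fun j : J₂ => (polys d).mkQ (conv (kernel (square (φ j))) f)) u₂ ∧
              (polys d).mkQ f = u₁ + u₂) ∧
            -- convergence in `𝒮'` after correction by polynomials of bounded degree
            ∀ m : ℕ, FourierOrderLE m f →
              ∀ F G : ℕ → Finset J, IsExhaustion J₁ F → IsExhaustion J₂ G →
                ∃ (Pk : ℕ → MvPolynomial (Fin d) ℂ) (P₀ : MvPolynomial (Fin d) ℂ),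
                  (∀ k, (Pk k).totalDegree ≤ p m) ∧
                  Tendsto (fun n : ℕ × ℕ =>
                      ∑ j ∈ F n.1, conv (kernel (square (φ j))) f +
                        ∑ j ∈ G n.2, conv (kernel (square (φ j))) f + polyDist (Pk n.1))
                    (atTop ×ˢ atTop) (𝓝 (f - polyDist P₀)) := by
  obtain ⟨α, hα, hαa⟩ := ha.exists_pos_le
  set κ : ℕ := ⌈r * d / α⌉₊ with hκ
  -- Each of `m` derivatives costs at most `κ` orders of vanishing in the multiplier and one order
  -- in the test function.
  refine ⟨fun m => κ * m + m, ?_⟩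
  intro J h δ ξ A b P Q Φ hh hδ hξ hcov hA hball hΦ
  obtain ⟨K, hK0, hK⟩ := hh.exists_bound_inv_rpow ha hδ hα hαa (Nat.le_ceil (r * d / α))
  have hAinv : ∀ j, ∀ ζ ∈ affImage (A j) (b j) Q, ζ ≠ 0 →
      ∀ η, ‖act (A j)⁻¹ η‖ ≤ K * blowup κ ζ * ‖η‖ := fun j ζ hζ hζ0 η => by
    have hpos : 0 < δ * h (ξ j) := mul_pos hδ (hh.pos ha (hξ j))
    have hb := blowup_pos κ ζ
    have h0 := hcov.zero_notMem_affImage j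
    rw [hball j] at hζ h0
    rw [hA j, inv_dilation a hpos]
    exact norm_act_dilation_le (by positivity) (by positivity)
      (hK (ξ j) (hξ j) h0 ζ hζ hζ0) η
  obtain ⟨φ, hφ, htame, hone⟩ := hΦ.exists_schwartz_sqrtBAPU hcov hK0 hAinv
  refine ⟨φ, hφ, ?_⟩
  rintro C hC J₁ J₂ hJ₂ rfl f
  obtain ⟨j₀⟩ := hcov.nonempty
  -- In dimension `0` there is no `ξ j₀ ≠ 0`.
  have : Nontrivial (E d) := ⟨ξ j₀, 0, hξ j₀⟩
  obtain ⟨c, hc, hcC⟩ := exists_pos_le_norm_of_le_anorm ha hC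
  have hhigh : ∀ j ∈ J₂, ∀ ζ ∈ affImage (A j) (b j) Q, c ≤ ‖ζ‖ := fun j hj ζ hζ => by
    rw [hJ₂] at hj
    rw [hball j] at hζ
    have hnot := Set.disjoint_left.mp hj hζ
    simp only [aball, Set.mem_ofPred_eq, sub_zero, not_lt] at hnot
    exact hcC ζ hnot
  have hmap : ∀ S : Set J, (∀ s : Finset S, ↑(s.map (Function.Embedding.subtype (· ∈ S))) ⊆ S) ∧
      ∀ j ∈ S, ∀ᶠ s : Finset S in atTop, j ∈ s.map (Function.Embedding.subtype (· ∈ S)) :=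
    fun S => ⟨fun s j hj => by
      obtain ⟨i, -, rfl⟩ := Finset.mem_map.mp (Finset.mem_coe.mp hj)
      exact i.2, fun j hj => by
      filter_upwards [eventually_ge_atTop {⟨j, hj⟩}] with s hs
      exact Finset.mem_map.mpr ⟨⟨j, hj⟩, Finset.singleton_subset_iff.mp hs, rfl⟩⟩
  have hexh : ∀ (S : Set J) (F : ℕ → Finset J), IsExhaustion S F →
      (∀ n, ↑(F n) ⊆ S) ∧ ∀ j ∈ S, ∀ᶠ n in atTop, j ∈ F n := fun S F hF =>
    ⟨fun n => hF.union ▸ Set.subset_iUnion (fun k => (F k : Set J)) n, fun j hj => by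
      rw [← hF.union] at hj
      obtain ⟨k, hk⟩ := Set.mem_iUnion.mp hj
      filter_upwards [eventually_ge_atTop k] with n hn using hF.mono hn hk⟩
  constructor
  · obtain ⟨m, hm⟩ := exists_fourierOrderLE f
    obtain ⟨R, R₀, -, hR⟩ := htame.exists_tendsto_sum_conv_low hone hc hhigh hm
      (hmap J₂ᶜ).1 (hmap J₂ᶜ).2
    have hG := htame.tendsto_sum_conv_high hc hhigh hm (hmap J₂).1 (hmap J₂).2
    have hlow := hasSum_mkQ hR
    have hhigh' := hasSum_mkQ (v := fun j => conv (kernel (square (φ j))) f) (R := fun _ => 0)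
      (hG.congr fun s => by rw [map_zero, add_zero])
    refine ⟨_, _, hlow, hhigh', ?_⟩
    rw [map_sub, mkQ_polyDist, sub_zero, map_sub, sub_add_cancel]
  · intro m hm F G hF hG
    obtain ⟨R, R₀, hdeg, hR⟩ := htame.exists_tendsto_sum_conv_low hone hc hhigh hm
      (hexh _ F hF).1 (hexh _ F hF).2
    have hG' := htame.tendsto_sum_conv_high hc hhigh hm (hexh _ G hG).1 (hexh _ G hG).2
    refine ⟨R, R₀, hdeg, ?_⟩
    have hsum := (hR.comp (tendsto_fst (f := atTop) (g := atTop))).add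
      (hG'.comp (tendsto_snd (f := atTop) (g := atTop)))
    rw [sub_right_comm, sub_add_cancel] at hsum
    refine hsum.congr fun n => ?_
    simp only [Function.comp_apply]
    abel
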